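/- **Setting.** Let $G$ be a Carnot group, i.e. a simply connected Lie group with a stratification $\mathfrak g=V_1\oplus\dots\oplus V_s$ of its Lie algebra, $[V_1,V_j]=V_{j+1}$ for $1\le j\le s$, $V_{s+1}=\{0\}$, endowed with the left-invariant distribution $\Delta$ with $\Delta_1=V_1$ and a left-invariant norm $\|\cdot\|$ on $\Delta$. For $r>0$ let $\delta_r:G\to G$ be the dilation, i.e. the Lie group automorphism whose differential at $1_G$ is multiplication by $r^j$ on $V_j$. Let $H<G$ be a closed subgroup with $\delta_r(H)\subseteq H$ for all $r>0$ and $T_1H\cap V_1=\{0\}$. Let $H\backslash G=\{Hg:g\in G\}$ carry the quotient smooth structure, for which $\pi:G\to H\backslash G$, $\pi(g)=Hg$, is a smooth submersion, the distribution $\bar\Delta=\pi_*\Delta$, and the norm $$\|v\|_p=\inf\{\|w\|_q : q\in\pi^{-1}(p),\ w\in\Delta_q,\ \mathrm d\pi_q(w)=v\},\qquad v\in\bar\Delta_p .$$ (Such a space is called a self-similar subFinsler space, and $\pi(1_G)=H$ is its origin.) Fix a left-invariant frame $X_1,\dots,X_m$ of $\Delta$ and let $\bar X_i=\pi_*X_i$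 be the projected vector fields on $H\backslash G$. A curve with control $u\in L^2([0,1],\mathbb R^m)$ is an absolutely continuous curve $\gamma:[0,1]\to H\backslash G$ with $\gamma'(t)=\sum_i u_i(t)\bar X_i(\gamma(t))$ for a.e. $t$. The flow $(\phi^t)_{t\in[0,1]}$ along $u$ is the family of diffeomorphisms of $H\backslash G$ such that, for each $p$, $t\mapsto\phi^t(p)$ is the curve with control $u$ starting at $p$; put $\phi_t^1=\phi^1\circ(\phi^t)^{-1}$. A curve $\gamma:[0,1]\to H\backslash G$ with control $u\in L^2([0,1],\mathbb R^m)$ is *normal* if there is $\lambda\in T^*_{\gamma(1)}(H\backslash G)$ such that for a.e. $t\in[0,1]$ the restriction of $(\phi_t^1)^*\lambda$ to $\bar\Delta_{\gamma(t)}$ is a sub-differential at $\gamma'(t)$ of the energy $\tfrac12\|\cdot\|^2_{\gamma(t)}:\bar\Delta_{\gamma(t)}\to\mathbb R$, where a linear map $a$ is a sub-differential of $f$ at $v$ if $a(w-v)\le f(w)-f(v)$ for all $w$. A curve $\gamma:[a,c]\to H\backslash G$, $a<c$, is called normal if its affine reparametrization on $[0,1]$ is normal. **Theorem 3.4.** Every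 normal loop in $H\backslash G$ based at the origin is constant: if $\gamma:[a,c]\to H\backslash G$, with $a<c$, is a normal curve with $\gamma(a)=\gamma(c)=\pi(1_G)$, then $\gamma(t)=\pi(1_G)$ for all $t\in[a,c]$. -/

import Mathlib

open Set MeasureTheory
open scoped Manifold ContDiff Topology

noncomputable section

/-! ### Control systems, flows and normal curves on a manifold -/

namespace SubFinsler

variable {E : Type*} [NormedAddCommGroup E] [NormedSpace ℝ E]
  {B : Type*} [TopologicalSpace B] (J : ModelWithCorners ℝ E B)
  {M : Type*} [TopologicalSpace M] [ChartedSpace B M] {m : ℕ}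

/-- Absolute continuity on `[0,1]` of a curve in a manifold: it is continuous and, on every compact
subinterval that it maps into the domain of a chart, its expression in that chart is absolutely
continuous. -/
def IsACCurve (γ : ℝ → M) : Prop :=
  ContinuousOn γ (Icc 0 1) ∧
    ∀ (x : M) (a b : ℝ), 0 ≤ a → a ≤ b → b ≤ 1 → MapsTo γ (Icc a b) (chartAt B x).source →
      AbsolutelyContinuousOnInterval (fun t => extChartAt J x (γ t)) a b

/-- The velocity `∑ i, c i • X i p` prescribed at `p` by the constant control `c`. -/
def controlVel (X : Fin m → (p : M) → TangentSpace J p) (c : Fin m → ℝ) (p : M) :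
    TangentSpace J p :=
  ∑ i, c i • X i p

/-- `γ` is a curve with control `u`: it is absolutely continuous on `[0,1]` and
`γ'(t) = ∑ i, u i (t) X i (γ t)` for almost every `t ∈ [0,1]`. (Curves on `[0,1]` are represented by
functions on `ℝ` whose values outside `[0,1]` play no role.) -/
def HasControl (X : Fin m → (p : M) → TangentSpace J p) (u : ℝ → Fin m → ℝ) (γ : ℝ → M) : Prop :=
  IsACCurve J γ ∧ ∀ᵐ t ∂(volume.restrict (Icc (0 : ℝ) 1)),
    HasMFDerivAt 𝓘(ℝ, ℝ) J γ t
      ((1 : ℝ →L[ℝ] ℝ).smulRight (controlVel J X (u t) (γ t)))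

/-- `φ` is the flow along the control `u`: for each point `p`, the curve `t ↦ φ t p` is the curve
with control `u` that starts at `p`. The maps `φ t` are diffeomorphisms of the manifold. -/
def IsFlowAlong (X : Fin m → (p : M) → TangentSpace J p) (u : ℝ → Fin m → ℝ)
    (φ : ℝ → (M ≃ₘ⟮J, J⟯ M)) : Prop :=
  ∀ p : M, φ 0 p = p ∧ HasControl J X u (fun t => φ t p)

/-- The flow `φ_s^t = φ^t ∘ (φ^s)⁻¹` from time `s` to time `t`. -/
def flowFromTo (φ : ℝ → (M ≃ₘ⟮J, J⟯ M)) (s t : ℝ) : M ≃ₘ⟮J, J⟯ M :=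
  (φ s).symm.trans (φ t)

/-- The distribution spanned by the vector fields `X i`. -/
def distribution (X : Fin m → (p : M) → TangentSpace J p) (p : M) :
    Submodule ℝ (TangentSpace J p) :=
  Submodule.span ℝ (range fun i => X i p)

/-- The energy `½ ‖·‖²` of a family of norms (which is only used on vectors of the distribution). -/
def energy (F : (p : M) → TangentSpace J p → ℝ) (p : M) (v : TangentSpace J p) : ℝ :=
  (1 / 2) * F p v ^ 2

/-- The restriction of the linear form `a` to the subspace `D` is a sub-differential at `v ∈ D` of
the restriction of `f` to `D`. -/
def IsSubdifferentialOn {T : Type*} [AddCommGroup T] [Module ℝ T] (D : Submodule ℝ T)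
    (f : T → ℝ) (v : T) (a : T → ℝ) : Prop :=
  v ∈ D ∧ ∀ w ∈ D, a (w - v) ≤ f w - f v

/-- `γ : [0,1] → M` is a normal curve, for the distribution spanned by the vector fields `X i` and
the norms `F`: it is the curve with an `L²` control `u` and, denoting by `φ` the flow along `u`,
there is a covector `λ ∈ T*_{γ 1} M` such that `(φ_t^1)^* λ` is a sub-differential of the energy at
`γ'(t)` for almost every `t`. Note that `φ_t^1 (γ t) = γ 1`, so that `λ` can be composed with the
differential of `φ_t^1` at `γ t`. -/
def IsNormalCurve (X : Fin m → (p : M) → TangentSpace J p)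
    (F : (p : M) → TangentSpace J p → ℝ) (γ : ℝ → M) : Prop :=
  ∃ (u : ℝ → Fin m → ℝ) (φ : ℝ → (M ≃ₘ⟮J, J⟯ M)) (l : TangentSpace J (γ 1) →L[ℝ] ℝ),
    MemLp u 2 (volume.restrict (Icc (0 : ℝ) 1)) ∧
    IsFlowAlong J X u φ ∧
    HasControl J X u γ ∧
    (∀ t ∈ Icc (0 : ℝ) 1, γ t = φ t (γ 0)) ∧
    ∀ᵐ t ∂(volume.restrict (Icc (0 : ℝ) 1)),
      IsSubdifferentialOn (distribution J X (γ t)) (energy J F (γ t))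
        (controlVel J X (u t) (γ t))
        (fun w => l (mfderiv J J (flowFromTo J φ t 1) (γ t) w))

end SubFinsler

/-! ### Stratified Lie groups and dilations -/

namespace Carnot

variable {n : ℕ} {G : Type*} [Group G] [TopologicalSpace G]
  [ChartedSpace (EuclideanSpace ℝ (Fin n)) G]

/-- `V 1, …, V s` is a stratification of the Lie algebra `𝔤` of `G`: `𝔤 = V 1 ⊕ … ⊕ V s` and
`[V 1, V j] = V (j + 1)` for `j = 1, …, s`, where `V (s + 1) = 0`. (The subspaces `V j` for the
other indices play no role.) -/
structure IsStratification (s : ℕ) (V : ℕ → Submodule ℝ (GroupLieAlgebra (𝓡 n) G)) : Prop where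
  isInternal : DirectSum.IsInternal fun j : Fin s => V (j + 1)
  bracket : ∀ j, 1 ≤ j → j ≤ s →
    Submodule.span ℝ {z | ∃ x ∈ V 1, ∃ y ∈ V j, ⁅x, y⁆ = z} = V (j + 1)
  eq_bot : V (s + 1) = ⊥

/-- `δ` is the dilation of factor `r`: the smooth group endomorphism whose differential at the
identity is the multiplication by `r ^ j` on `V j`. -/
def IsDilation (s : ℕ) (V : ℕ → Submodule ℝ (GroupLieAlgebra (𝓡 n) G)) (r : ℝ) (δ : G →* G) :
    Prop :=
  ContMDiff (𝓡 n) (𝓡 n) ∞ δ ∧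
    ∀ j, 1 ≤ j → j ≤ s → ∀ v ∈ V j,
      tangentMap (𝓡 n) (𝓡 n) δ ⟨1, v⟩ =
        (⟨1, (r ^ j • v : GroupLieAlgebra (𝓡 n) G)⟩ : TangentBundle (𝓡 n) G)

/-- The subgroup `H` is invariant under the dilations of `G` (each of which is unique, as a smooth
homomorphism of a connected Lie group is determined by its differential). -/
def IsDilationInvariant (s : ℕ) (V : ℕ → Submodule ℝ (GroupLieAlgebra (𝓡 n) G))
    (H : Subgroup G) : Prop :=
  ∀ r : ℝ, 0 < r → ∃ δ : G →* G, IsDilation s V r δ ∧ ∀ h ∈ H, δ h ∈ H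

/-- The tangent space at the identity of a (closed) subgroup: velocities at the identity of the
smooth curves of `G` contained in `H`. -/
def tangentAtOne (H : Subgroup G) : Set (GroupLieAlgebra (𝓡 n) G) :=
  {v | ∃ c : ℝ → G, ContMDiff 𝓘(ℝ, ℝ) (𝓡 n) ∞ c ∧ (∀ t, c t ∈ H) ∧
    tangentMap 𝓘(ℝ, ℝ) (𝓡 n) c ⟨0, (1 : ℝ)⟩ = (⟨1, v⟩ : TangentBundle (𝓡 n) G)}

/-! ### The quotient `H \ G` -/

/-- The space `H \ G = {H g : g ∈ G}` of right cosets, with the quotient topology. -/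
abbrev RightQuotient (H : Subgroup G) : Type _ :=
  Quotient (QuotientGroup.rightRel H)

/-- The projection `g ↦ H g`. -/
def proj (H : Subgroup G) (g : G) : RightQuotient H :=
  Quotient.mk (QuotientGroup.rightRel H) g

variable {k : ℕ} (H : Subgroup G) [ChartedSpace (EuclideanSpace ℝ (Fin k)) (RightQuotient H)]

/-- The vector field on `H \ G` that is the image under the projection of the left-invariant vector
field of `w ∈ 𝔤`. It is computed at an arbitrary representative `q` of the coset `p`; by left
invariance the choice does not matter, see `projField_proj`. -/
def projField (w : GroupLieAlgebra (𝓡 n) G) (p : RightQuotient H) : TangentSpace (𝓡 k) p :=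
  have hp : proj H p.out = p := Quotient.out_eq p
  hp ▸ (mfderiv (𝓡 n) (𝓡 k) (proj H) p.out (mulInvariantVectorField w p.out) :
    TangentSpace (𝓡 k) (proj H p.out))

/-- The field `projField H w` as a map to the tangent bundle. -/
theorem mk_projField (w : GroupLieAlgebra (𝓡 n) G) (p : RightQuotient H) :
    (⟨p, projField (k := k) H w p⟩ : TangentBundle (𝓡 k) (RightQuotient H)) =
      tangentMap (𝓡 n) (𝓡 k) (proj H) ⟨p.out, mulInvariantVectorField w p.out⟩ := by
  have key : ∀ (p' : RightQuotient H) (hp : p' = p) (v : TangentSpace (𝓡 k) p'),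
      (⟨p, hp ▸ v⟩ : TangentBundle (𝓡 k) (RightQuotient H)) = ⟨p', v⟩ := by
    intro p' hp v
    subst hp
    rfl
  exact key (proj H p.out) (Quotient.out_eq p) _

/-- If the projection is differentiable, then `projField H w` is the image of the left-invariant
vector field of `w` at every point. -/
theorem projField_proj [LieGroup (𝓡 n) ∞ G] (hπ : MDifferentiable (𝓡 n) (𝓡 k) (proj H))
    (w : GroupLieAlgebra (𝓡 n) G) (q : G) :
    projField H w (proj H q) =
      mfderiv (𝓡 n) (𝓡 k) (proj H) q (mulInvariantVectorField w q) := by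
  have hL : ∀ g x : G, MDifferentiableAt (𝓡 n) (𝓡 n) (fun y : G => g * y) x := fun g x =>
    (contMDiff_mul_left (I := 𝓡 n) (n := ∞) (a := g)).mdifferentiableAt (by simp)
  have hrel : (proj H q).out * q⁻¹ ∈ H :=
    QuotientGroup.rightRel_apply.1
      (Quotient.exact (s := QuotientGroup.rightRel H) (Quotient.out_eq (proj H q)).symm)
  obtain ⟨h, hh, hq⟩ : ∃ h ∈ H, (proj H q).out = h * q := ⟨_, hrel, by group⟩
  have hcomp : proj H ∘ (fun y : G => h * y) = proj H := by
    funext y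
    refine Quotient.sound (s := QuotientGroup.rightRel H) ?_
    refine QuotientGroup.rightRel_apply.2 ?_
    simpa using H.inv_mem hh
  have h1 : mulInvariantVectorField (I := 𝓡 n) w (h * q) =
      mfderiv (𝓡 n) (𝓡 n) (fun y : G => h * y) q (mulInvariantVectorField w q) := by
    have h2 : (fun y : G => h * q * y) = (fun y : G => h * y) ∘ (fun y : G => q * y) := by
      funext y
      simp [mul_assoc]
    have h4 : HasMFDerivAt (𝓡 n) (𝓡 n) (fun y : G => h * y) (q * 1)
        (mfderiv (𝓡 n) (𝓡 n) (fun y : G => h * y) q) := by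
      rw [mul_one]
      exact (hL h q).hasMFDerivAt
    have h3 := h4.comp (1 : G) (hL q 1).hasMFDerivAt
    rw [← h2] at h3
    have h5 := h3.mfderiv
    exact congrArg (fun L : EuclideanSpace ℝ (Fin n) →L[ℝ] EuclideanSpace ℝ (Fin n) => L w) h5
  have htan : tangentMap (𝓡 n) (𝓡 k) (proj H) ⟨h * q, mulInvariantVectorField w (h * q)⟩ =
      tangentMap (𝓡 n) (𝓡 k) (proj H) ⟨q, mulInvariantVectorField w q⟩ := by
    have h6 := tangentMap_comp_at (I := 𝓡 n) (I' := 𝓡 n) (I'' := 𝓡 k) (f := fun y : G => h * y)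
      (g := proj H) (⟨q, mulInvariantVectorField w q⟩ : TangentBundle (𝓡 n) G) (hπ _) (hL h q)
    rw [hcomp] at h6
    rw [h6, h1]
    rfl
  have hfin := mk_projField (k := k) H w (proj H q)
  rw [hq, htan] at hfin
  exact eq_of_heq (Bundle.TotalSpace.mk.inj hfin).2

/-- The quotient norm on the projected distribution: the infimum of the norms of the horizontal
vectors of `G` that are mapped to `v`. The horizontal vectors at `q` are the values at `q` of the
left-invariant vector fields of the elements `w` of `V₁`, and their norm is `N w` by left
invariance. -/
def quotientNorm {V₁ : Submodule ℝ (GroupLieAlgebra (𝓡 n) G)} (N : Seminorm ℝ V₁)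
    (p : RightQuotient H) (v : TangentSpace (𝓡 k) p) : ℝ :=
  sInf {r : ℝ | ∃ (q : G) (w : V₁),
    tangentMap (𝓡 n) (𝓡 k) (proj H)
        ⟨q, mulInvariantVectorField (w : GroupLieAlgebra (𝓡 n) G) q⟩ =
      (⟨p, v⟩ : TangentBundle (𝓡 k) (RightQuotient H)) ∧ r = N w}

end Carnot

end

/-!
The theorem rests on one variation of the loop: its images under the dilations. Since the dilation
`δ_r` preserves `H`, it induces a map of `H \ G` that fixes the origin and multiplies the control of
a horizontal curve by `r`; so the controls `r u` all give loops at the origin, and the first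
variation of the endpoint in the direction `u` vanishes. Pairing it with the covector `λ` of the
normal curve gives `∫ ((φ_t^1)^* λ)(γ'(t)) dt = 0`. On the other hand, testing the sub-differential
inequality on the vector `0` gives `((φ_t^1)^* λ)(γ'(t)) ≥ ½ ‖γ'(t)‖²`. Hence `γ' = 0` almost
everywhere, and `γ` is constant.

The flow is made explicit by a lift to `G`. If `g` solves `g' = g · w` with `g 0 = 1`, where `w` is
the control read in the first layer of the Lie algebra (`SubFinsler.exists_hasLeftVelocity`, by the
Banach fixed point theorem in a chart and gluing by left translations), then
`φ^t (H x) = H x g(t)` (`Carnot.eq_act_of_velocity`): the curve `φ^t (p) · g(t)⁻¹` is absolutely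
continuous, by the smoothness of the right action of `G` on `H \ G`, and its velocity vanishes.

The first variation is computed for the curves `y_r(t) = δ_r(g(t)) g(t)⁻¹` of `G`. For a smooth
function `h` with compact support, `h ∘ y_r` has derivative `r - 1` times a bounded multiple of
`‖w‖` (`SubFinsler.diffAt_dilation`). Applied to bump functions at `1`, this shows that `y_r(t)`
tends to `1` as `r → 1` (`SubFinsler.tendsto_dilation_mul_inv`), without any regularity of `δ_r`
in `r`. Applied to a function `h` that near `1` is the pullback by `x ↦ φ^1 (H x)` of a function on
`H \ G` with differential `λ`, it gives the vanishing of the integral by dominated convergence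
(`SubFinsler.integral_conjDiff_eq_zero`), because `y_r(1) ∈ H` and `h` is constant on `H` near `1`.
-/

noncomputable section

open Filter

/-! ### Absolutely continuous functions on `[0,1]` -/

namespace SubFinsler

section RealLine

variable {X Y : Type*} [PseudoMetricSpace X] [PseudoMetricSpace Y]

theorem _root_.AbsolutelyContinuousOnInterval.of_dist_le {f : ℝ → X} {h : ℝ → Y} {a b K : ℝ}
    (hf : AbsolutelyContinuousOnInterval f a b)
    (hle : ∀ s ∈ uIcc a b, ∀ t ∈ uIcc a b, dist (h s) (h t) ≤ K * dist (f s) (f t)) :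
    AbsolutelyContinuousOnInterval h a b := by
  unfold AbsolutelyContinuousOnInterval at *
  have h2 := hf.const_mul K
  rw [mul_zero] at h2
  refine squeeze_zero' (Eventually.of_forall fun E => Finset.sum_nonneg fun _ _ => dist_nonneg)
    ?_ h2
  filter_upwards [mem_inf_of_right (mem_principal_self _)] with E hE
  rw [Finset.mul_sum]
  exact Finset.sum_le_sum fun i hi => hle _ (hE.1 i hi).1 _ (hE.1 i hi).2

theorem _root_.AbsolutelyContinuousOnInterval.congr {f h : ℝ → X} {a b : ℝ}
    (hf : AbsolutelyContinuousOnInterval f a b) (hfh : EqOn h f (uIcc a b)) :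
    AbsolutelyContinuousOnInterval h a b :=
  hf.of_dist_le (K := 1) fun s hs t ht => by rw [hfh hs, hfh ht, one_mul]

theorem _root_.AbsolutelyContinuousOnInterval.prodMk {f : ℝ → X} {h : ℝ → Y} {a b : ℝ}
    (hf : AbsolutelyContinuousOnInterval f a b) (hh : AbsolutelyContinuousOnInterval h a b) :
    AbsolutelyContinuousOnInterval (fun t => (f t, h t)) a b := by
  unfold AbsolutelyContinuousOnInterval at *
  have h2 := hf.add hh
  rw [add_zero] at h2
  refine squeeze_zero (fun E => Finset.sum_nonneg fun _ _ => dist_nonneg) (fun E => ?_) h2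
  rw [← Finset.sum_add_distrib]
  refine Finset.sum_le_sum fun i _ => ?_
  rw [Prod.dist_eq]
  exact max_le_add_of_nonneg dist_nonneg dist_nonneg

/-- `f` is absolutely continuous on all the compact subintervals of `[0,1]` that lie in some
neighbourhood of `t₀`. -/
def ACNear (f : ℝ → X) (t₀ : ℝ) : Prop :=
  ∃ U ∈ 𝓝 t₀, ∀ a b, a ≤ b → Icc a b ⊆ Icc 0 1 ∩ U → AbsolutelyContinuousOnInterval f a b

theorem ACNear.comp_lipschitzOnWith {f : ℝ → X} {t₀ : ℝ} (hf : ACNear f t₀)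
    (hc : ContinuousWithinAt f (Icc 0 1) t₀) {F : X → Y} {K : NNReal} {s : Set X}
    (hs : s ∈ 𝓝 (f t₀)) (hF : LipschitzOnWith K F s) : ACNear (fun t => F (f t)) t₀ := by
  obtain ⟨U, hU, hUf⟩ := hf
  obtain ⟨W, hW, hWs⟩ := mem_nhdsWithin_iff_exists_mem_nhds_inter.1 (hc hs)
  refine ⟨U ∩ W, inter_mem hU hW, fun a b hab hI => ?_⟩
  refine (hUf a b hab fun t ht => ⟨(hI ht).1, (hI ht).2.1⟩).of_dist_le (K := K) ?_
  intro t ht t' ht'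
  rw [uIcc_of_le hab] at ht ht'
  exact hF.dist_le_mul _ (hWs ⟨(hI ht).2.2, (hI ht).1⟩) _ (hWs ⟨(hI ht').2.2, (hI ht').1⟩)

theorem ACNear.congr {f h : ℝ → X} {t₀ : ℝ} (hf : ACNear f t₀)
    (hfh : h =ᶠ[𝓝[Icc 0 1] t₀] f) : ACNear h t₀ := by
  obtain ⟨U, hU, hUf⟩ := hf
  obtain ⟨W, hW, hWs⟩ := mem_nhdsWithin_iff_exists_mem_nhds_inter.1 hfh
  refine ⟨U ∩ W, inter_mem hU hW, fun a b hab hI => ?_⟩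
  refine (hUf a b hab fun t ht => ⟨(hI ht).1, (hI ht).2.1⟩).congr fun t ht => ?_
  rw [uIcc_of_le hab] at ht
  exact hWs ⟨(hI ht).2.2, (hI ht).1⟩

theorem ACNear.prodMk {f : ℝ → X} {h : ℝ → Y} {t₀ : ℝ} (hf : ACNear f t₀) (hh : ACNear h t₀) :
    ACNear (fun t => (f t, h t)) t₀ := by
  obtain ⟨U, hU, hUf⟩ := hf
  obtain ⟨W, hW, hWh⟩ := hh
  refine ⟨U ∩ W, inter_mem hU hW, fun a b hab hI => ?_⟩
  exact (hUf a b hab fun t ht => ⟨(hI ht).1, (hI ht).2.1⟩).prodMk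
    (hWh a b hab fun t ht => ⟨(hI ht).1, (hI ht).2.2⟩)

/-- A function on `[0,1]` that is locally constant is constant. -/
theorem eq_of_eventually_eq_Icc {T : Type*} {f : ℝ → T}
    (hf : ∀ t₀ ∈ Icc (0 : ℝ) 1, ∀ᶠ t in 𝓝[Icc 0 1] t₀, f t = f t₀) :
    ∀ t ∈ Icc (0 : ℝ) 1, f t = f 0 := by
  have hloc : IsLocallyConstant (fun t : Icc (0 : ℝ) 1 => f t) := by
    rw [IsLocallyConstant.iff_eventually_eq]
    intro t
    have := hf t t.2
    rwa [nhdsWithin_eq_map_subtype_coe t.2, eventually_map] at this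
  intro t ht
  exact hloc.apply_eq_of_preconnectedSpace ⟨t, ht⟩ ⟨0, by simp⟩

theorem ACNear.eventually_eq {F : Type*} [NormedAddCommGroup F] [NormedSpace ℝ F] {f : ℝ → F}
    {t₀ : ℝ} (hf : ACNear f t₀) (ht₀ : t₀ ∈ Icc (0 : ℝ) 1)
    (hd : ∀ᶠ s in 𝓝 t₀, ∀ᵐ t, t ∈ Icc (0 : ℝ) 1 → t ∈ uIcc t₀ s → HasDerivAt f 0 t) :
    ∀ᶠ t in 𝓝[Icc 0 1] t₀, f t = f t₀ := by
  obtain ⟨U, hU, hUf⟩ := hf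
  obtain ⟨ε, hε, hεU⟩ := Metric.mem_nhds_iff.1 hU
  filter_upwards [self_mem_nhdsWithin, mem_nhdsWithin_of_mem_nhds (Metric.ball_mem_nhds t₀ hε),
    mem_nhdsWithin_of_mem_nhds hd] with t ht htε htd
  have hsub : uIcc t₀ t ⊆ Icc 0 1 ∩ U := by
    intro s hs
    refine ⟨(ordConnected_Icc.uIcc_subset ht₀ ht) hs, hεU ?_⟩
    exact (convex_ball t₀ ε).ordConnected.uIcc_subset (Metric.mem_ball_self hε) htε hs
  have hac : AbsolutelyContinuousOnInterval f t₀ t := by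
    refine (hUf (min t₀ t) (max t₀ t) min_le_max hsub).mono ?_
    rw [uIcc_of_le min_le_max]
    exact Subset.rfl
  obtain ⟨C, hC⟩ := hac.const_of_ae_hasDerivAt_zero (by
    filter_upwards [htd] with s hs hst using hs (hsub hst).1 hst)
  rw [hC _ right_mem_uIcc, hC _ left_mem_uIcc]

/-- The fundamental theorem of calculus for a function that is absolutely continuous near each
point of `[0,1]`. -/
theorem sub_eq_integral_of_ACNear {f v : ℝ → ℝ} (hf : ∀ t ∈ Icc (0 : ℝ) 1, ACNear f t)
    (hv : IntervalIntegrable v volume 0 1)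
    (hd : ∀ᵐ t, t ∈ Icc (0 : ℝ) 1 → HasDerivAt f (v t) t) :
    ∀ t ∈ Icc (0 : ℝ) 1, f t - f 0 = ∫ s in (0 : ℝ)..t, v s := by
  have hV : AbsolutelyContinuousOnInterval (fun t => ∫ s in (0 : ℝ)..t, v s) 0 1 :=
    hv.absolutelyContinuousOnInterval_intervalIntegral left_mem_uIcc
  have hVd := hv.ae_hasDerivAt_integral
  have key : ∀ t ∈ Icc (0 : ℝ) 1, f t - (∫ s in (0 : ℝ)..t, v s)
      = f 0 - ∫ s in (0 : ℝ)..0, v s := by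
    refine eq_of_eventually_eq_Icc (f := fun t => f t - (∫ s in (0 : ℝ)..t, v s))
      fun t₀ ht₀ => ACNear.eventually_eq ?_ ht₀ (Eventually.of_forall fun s => ?_)
    · obtain ⟨U, hU, hUf⟩ := hf t₀ ht₀
      refine ⟨U, hU, fun a b hab hI => (hUf a b hab hI).fun_sub (hV.mono ?_)⟩
      rw [uIcc_of_le hab, uIcc_of_le zero_le_one]
      exact fun x hx => (hI hx).1
    · filter_upwards [hd, hVd] with t h1 h2 ht _
      have h3 := (h1 ht).sub (h2 (by rwa [uIcc_of_le zero_le_one]) 0 left_mem_uIcc)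
      rwa [sub_self] at h3
  intro t ht
  have := key t ht
  rw [intervalIntegral.integral_same, sub_zero] at this
  linarith

end RealLine

end SubFinsler

/-! ### Absolutely continuous curves in manifolds -/

namespace SubFinsler

section Curves

variable {E : Type*} [NormedAddCommGroup E] [NormedSpace ℝ E]
  {B : Type*} [TopologicalSpace B] {J : ModelWithCorners ℝ E B}
  {M : Type*} [TopologicalSpace M] [ChartedSpace B M]
  {E' : Type*} [NormedAddCommGroup E'] [NormedSpace ℝ E']
  {B' : Type*} [TopologicalSpace B'] {J' : ModelWithCorners ℝ E' B'}
  {M' : Type*} [TopologicalSpace M'] [ChartedSpace B' M']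

variable (J) in
/-- Absolute continuity near `t₀ ∈ [0,1]` of a curve in a manifold, read in the preferred chart at
the point `c t₀`. -/
def ACCurveAt (c : ℝ → M) (t₀ : ℝ) : Prop :=
  ContinuousWithinAt c (Icc 0 1) t₀ ∧ ACNear (fun t => extChartAt J (c t₀) (c t)) t₀

theorem IsACCurve.acCurveAt {c : ℝ → M} (hc : IsACCurve J c) {t₀ : ℝ}
    (ht₀ : t₀ ∈ Icc (0 : ℝ) 1) : ACCurveAt J c t₀ := by
  refine ⟨hc.1 t₀ ht₀, ?_⟩
  obtain ⟨W, hW, hWs⟩ := mem_nhdsWithin_iff_exists_mem_nhds_inter.1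
    (hc.1 t₀ ht₀ (chart_source_mem_nhds B (c t₀)))
  refine ⟨W, hW, fun a b hab hI => hc.2 (c t₀) a b ?_ hab ?_ fun t ht => ?_⟩
  · exact (hI (left_mem_Icc.2 hab)).1.1
  · exact (hI (right_mem_Icc.2 hab)).1.2
  · exact hWs ⟨(hI ht).2, (hI ht).1⟩

theorem ACCurveAt.comp [J.Boundaryless] {c : ℝ → M} {t₀ : ℝ} (hc : ACCurveAt J c t₀) {F : M → M'}
    (hF : ContMDiffAt J J' 1 F (c t₀)) : ACCurveAt J' (fun t => F (c t)) t₀ := by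
  refine ⟨hF.continuousAt.comp_continuousWithinAt hc.1, ?_⟩
  have hd : ContDiffAt ℝ 1 (writtenInExtChartAt J J' (c t₀) F) (extChartAt J (c t₀) (c t₀)) := by
    have := (contMDiffAt_iff.1 hF).2
    rwa [J.range_eq_univ, contDiffWithinAt_univ] at this
  obtain ⟨K, s, hs, hK⟩ := hd.exists_lipschitzOnWith
  refine (hc.2.comp_lipschitzOnWith
    ((continuousAt_extChartAt (c t₀)).comp_continuousWithinAt hc.1) hs hK).congr ?_
  filter_upwards [hc.1 (extChartAt_source_mem_nhds (I := J) (c t₀))] with t ht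
  simp only [writtenInExtChartAt, Function.comp_apply]
  rw [(extChartAt J (c t₀)).left_inv ht]

theorem ACCurveAt.prodMk {c : ℝ → M} {c' : ℝ → M'} {t₀ : ℝ} (hc : ACCurveAt J c t₀)
    (hc' : ACCurveAt J' c' t₀) : ACCurveAt (J.prod J') (fun t => (c t, c' t)) t₀ := by
  refine ⟨hc.1.prodMk hc'.1, ?_⟩
  simp only [extChartAt_prod]
  exact hc.2.prodMk hc'.2

theorem hasDerivAt_comp_of_hasMFDerivAt {c : ℝ → M} {t : ℝ} {v : TangentSpace J (c t)}
    (hc : HasMFDerivAt 𝓘(ℝ, ℝ) J c t ((1 : ℝ →L[ℝ] ℝ).smulRight v)) {F : M → E'}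
    (hF : MDifferentiableAt J 𝓘(ℝ, E') F (c t)) :
    HasDerivAt (fun s => F (c s)) (mfderiv J 𝓘(ℝ, E') F (c t) v : E') t := by
  let D : ℝ →L[ℝ] E' := (mfderiv J 𝓘(ℝ, E') F (c t)).comp ((1 : ℝ →L[ℝ] ℝ).smulRight v)
  have h1 : HasFDerivAt (fun s => F (c s)) D t :=
    hasMFDerivAt_iff_hasFDerivAt.1 (hF.hasMFDerivAt.comp t hc)
  exact h1.hasDerivAt.congr_deriv (congrArg (mfderiv J 𝓘(ℝ, E') F (c t)) (one_smul ℝ v))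

/-- The fundamental theorem of calculus for a function along an absolutely continuous curve. -/
theorem sub_eq_integral_of_acCurveAt [J.Boundaryless] {c : ℝ → M}
    (hc : ∀ t ∈ Icc (0 : ℝ) 1, ACCurveAt J c t) {V : (t : ℝ) → TangentSpace J (c t)}
    (hV : ∀ᵐ t, t ∈ Icc (0 : ℝ) 1 →
      HasMFDerivAt 𝓘(ℝ, ℝ) J c t ((1 : ℝ →L[ℝ] ℝ).smulRight (V t)))
    {F : M → ℝ} (hF : ContMDiff J 𝓘(ℝ, ℝ) 1 F) {v : ℝ → ℝ}
    (hv : IntervalIntegrable v volume 0 1)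
    (hFv : ∀ t ∈ Icc (0 : ℝ) 1, (mfderiv J 𝓘(ℝ, ℝ) F (c t) (V t) : ℝ) = v t) :
    ∀ t ∈ Icc (0 : ℝ) 1, F (c t) - F (c 0) = ∫ s in (0 : ℝ)..t, v s := by
  refine sub_eq_integral_of_ACNear (f := fun t => F (c t)) (fun t ht => ?_) hv ?_
  · exact ((hc t ht).comp (hF (c t))).2
  · filter_upwards [hV] with t h ht
    rw [← hFv t ht]
    exact hasDerivAt_comp_of_hasMFDerivAt (h ht) (hF.mdifferentiableAt one_ne_zero)

/-- An absolutely continuous curve whose velocity vanishes almost everywhere is constant. -/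
theorem eq_of_acCurveAt_of_velocity_zero [IsManifold J 1 M] {c : ℝ → M}
    (hc : ∀ t ∈ Icc (0 : ℝ) 1, ACCurveAt J c t)
    (hV : ∀ᵐ t, t ∈ Icc (0 : ℝ) 1 →
      HasMFDerivAt 𝓘(ℝ, ℝ) J c t ((1 : ℝ →L[ℝ] ℝ).smulRight (0 : TangentSpace J (c t)))) :
    ∀ t ∈ Icc (0 : ℝ) 1, c t = c 0 := by
  refine eq_of_eventually_eq_Icc fun t₀ ht₀ => ?_
  have hsrc := (hc t₀ ht₀).1 (chart_source_mem_nhds B (c t₀))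
  obtain ⟨W, hW, hWs⟩ := mem_nhdsWithin_iff_exists_mem_nhds_inter.1 hsrc
  obtain ⟨ε, hε, hεW⟩ := Metric.mem_nhds_iff.1 hW
  have hev := (hc t₀ ht₀).2.eventually_eq ht₀ (by
    filter_upwards [Metric.ball_mem_nhds t₀ hε] with s hs
    filter_upwards [hV] with t h ht hts
    have htW : t ∈ W :=
      hεW ((convex_ball t₀ ε).ordConnected.uIcc_subset (Metric.mem_ball_self hε) hs hts)
    have := hasDerivAt_comp_of_hasMFDerivAt (h ht) (F := extChartAt J (c t₀))
      (mdifferentiableAt_extChartAt (hWs ⟨htW, ht⟩))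
    rwa [show (mfderiv J 𝓘(ℝ, E) (extChartAt J (c t₀)) (c t) (0 : TangentSpace J (c t)) : E) = 0
      from map_zero _] at this)
  filter_upwards [hev, hsrc] with t h1 h2
  exact (extChartAt J (c t₀)).injOn (by rwa [extChartAt_source])
    (mem_extChartAt_source (c t₀)) h1

end Curves

end SubFinsler

/-! ### Carathéodory differential equations -/

namespace SubFinsler

section IntegralEquation

variable {E : Type*} [NormedAddCommGroup E] [NormedSpace ℝ E]

theorem norm_intervalIntegral_le_of_norm_le {F w : ℝ → E} {C : ℝ} (hC : 0 ≤ C)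
    (hw : Integrable w) (hF : ∀ s, ‖F s‖ ≤ C * ‖w s‖) (a b : ℝ) :
    ‖∫ s in a..b, F s‖ ≤ C * ∫ s, ‖w s‖ := by
  refine (intervalIntegral.norm_integral_le_abs_of_norm_le (g := fun s => C * ‖w s‖)
    (Eventually.of_forall fun s => hF s) (hw.norm.const_mul C).intervalIntegrable).trans ?_
  rw [← integral_const_mul, intervalIntegral.abs_intervalIntegral_eq]
  rw [abs_of_nonneg (integral_nonneg fun s => by positivity)]
  exact setIntegral_le_integral (hw.norm.const_mul C)
    (Eventually.of_forall fun s => by positivity)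

theorem integrable_clm_apply_of_bound {A : ℝ → E →L[ℝ] E} (hA : Continuous A) {C : ℝ}
    (hC : ∀ s, ‖A s‖ ≤ C) {w : ℝ → E} (hw : Integrable w) :
    Integrable fun s => A s (w s) := by
  refine (hw.norm.const_mul C).mono' ?_ (Eventually.of_forall fun s => ?_)
  · exact isBoundedBilinearMap_apply.continuous.comp_aestronglyMeasurable₂
      hA.aestronglyMeasurable hw.1
  · exact (A s).le_of_opNorm_le (hC s) _

/-- Existence for the Carathéodory equation `x' = A(x) w(t)` with a globally Lipschitz `A` and an
integrable `w` of small mass, by the Banach fixed point theorem. -/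
theorem exists_integral_solution [CompleteSpace E] {A : E → E →L[ℝ] E} {K : NNReal}
    (hA : LipschitzWith K A) {w : ℝ → E} (hw : Integrable w) (hsmall : K * ∫ s, ‖w s‖ ≤ 1 / 2)
    (x₀ : E) :
    ∃ x : BoundedContinuousFunction ℝ E,
      Integrable (fun s => A (x s) (w s)) ∧ ∀ t, x t = x₀ + ∫ s in (0 : ℝ)..t, A (x s) (w s) := by
  have hbd : ∀ x : BoundedContinuousFunction ℝ E, ∀ s, ‖A (x s)‖ ≤ ‖A 0‖ + K * ‖x‖ := fun x s => by
    have h1 := hA.dist_le_mul (x s) 0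
    rw [dist_eq_norm, dist_zero_right] at h1
    have h2 : ‖A (x s)‖ ≤ ‖A 0‖ + ‖A (x s) - A 0‖ := by
      simpa using norm_add_le (A 0) (A (x s) - A 0)
    have h3 : (K : ℝ) * ‖x s‖ ≤ K * ‖x‖ := by gcongr; exact x.norm_coe_le_norm s
    linarith
  have hint : ∀ x : BoundedContinuousFunction ℝ E, Integrable fun s => A (x s) (w s) := fun x =>
    integrable_clm_apply_of_bound (hA.continuous.comp x.continuous) (hbd x) hw
  let T : BoundedContinuousFunction ℝ E → BoundedContinuousFunction ℝ E := fun x =>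
    BoundedContinuousFunction.ofNormedAddCommGroup
      (fun t => x₀ + ∫ s in (0 : ℝ)..t, A (x s) (w s))
      (continuous_const.add (intervalIntegral.continuous_primitive
        (fun a b => (hint x).intervalIntegrable) 0))
      (‖x₀‖ + (‖A 0‖ + K * ‖x‖) * ∫ s, ‖w s‖)
      (fun t => (norm_add_le _ _).trans (add_le_add_right
        (norm_intervalIntegral_le_of_norm_le (by positivity) hw
          (fun s => (A (x s)).le_of_opNorm_le (hbd x s) _) 0 t) _))
  have hT : ContractingWith (1 / 2) T := by
    refine ⟨by norm_num, LipschitzWith.of_dist_le_mul fun x y => ?_⟩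
    refine (BoundedContinuousFunction.dist_le (by positivity)).2 fun t => ?_
    have h1 : T x t - T y t = ∫ s in (0 : ℝ)..t, (A (x s) (w s) - A (y s) (w s)) := by
      rw [intervalIntegral.integral_sub (hint x).intervalIntegrable (hint y).intervalIntegrable]
      simp [T]
    rw [dist_eq_norm, h1]
    refine (norm_intervalIntegral_le_of_norm_le (C := K * dist x y) (by positivity) hw
      (fun s => ?_) 0 t).trans ?_
    · rw [← sub_apply]
      refine ContinuousLinearMap.le_of_opNorm_le _ ?_ _
      rw [← dist_eq_norm]
      refine (hA.dist_le_mul _ _).trans ?_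
      gcongr
      exact BoundedContinuousFunction.dist_coe_le_dist s
    · have : ((1 / 2 : NNReal) : ℝ) = 1 / 2 := by simp
      rw [this]
      nlinarith [dist_nonneg (x := x) (y := y)]
  refine ⟨hT.fixedPoint T, hint _, fun t => ?_⟩
  exact congrArg (fun f : BoundedContinuousFunction ℝ E => f t) hT.fixedPoint_isFixedPt.symm

theorem absolutelyContinuousOnInterval_integral {v : ℝ → E} (hv : Integrable v) (x₀ : E)
    (a b : ℝ) : AbsolutelyContinuousOnInterval (fun t => x₀ + ∫ s in (0 : ℝ)..t, v s) a b := by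
  have h := IntervalIntegrable.absolutelyContinuousOnInterval_intervalIntegral
    (hv.norm.intervalIntegrable (a := a) (b := b)) left_mem_uIcc
  refine h.of_dist_le (K := 1) fun s _ t _ => ?_
  rw [dist_add_left, dist_eq_norm, dist_eq_norm, one_mul,
    intervalIntegral.integral_interval_sub_left hv.intervalIntegrable hv.intervalIntegrable,
    intervalIntegral.integral_interval_sub_left hv.norm.intervalIntegrable
      hv.norm.intervalIntegrable]
  exact intervalIntegral.norm_integral_le_abs_integral_norm

end IntegralEquation

section Parametric

variable {E : Type*} [NormedAddCommGroup E] [NormedSpace ℝ E]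
  {B : Type*} [TopologicalSpace B] {J : ModelWithCorners ℝ E B}
  {M : Type*} [TopologicalSpace M] [ChartedSpace B M] [IsManifold J ∞ M]
  {E₁ : Type*} [NormedAddCommGroup E₁] [NormedSpace ℝ E₁]
  {B₁ : Type*} [TopologicalSpace B₁] {J₁ : ModelWithCorners ℝ E₁ B₁}
  {N : Type*} [TopologicalSpace N] [ChartedSpace B₁ N] [IsManifold J₁ ∞ N]
  {F : Type*} [NormedAddCommGroup F] [NormedSpace ℝ F]

variable (J) in
/-- The differential at `p` of a function with values in a vector space, as a linear map on the
model space, to which `TangentSpace J p` unfolds. -/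
def diffAt (f : M → F) (p : M) : E →L[ℝ] F := mfderiv J 𝓘(ℝ, F) f p

/-- The differential at a fixed point of a family of functions depends smoothly on the
parameter. -/
theorem contMDiffAt_mfderiv_of_param {f : N → M → F} {x₀ : N} {p : M}
    (hf : ContMDiffAt (J₁.prod J) 𝓘(ℝ, F) ∞ (Function.uncurry f) (x₀, p)) :
    ContMDiffAt J₁ 𝓘(ℝ, E →L[ℝ] F) 1
      (fun x => diffAt J (f x) p) x₀ := by
  have h := ContMDiffAt.mfderiv (m := 1) f (fun _ => p) hf contMDiffAt_const
    (by rw [one_add_one_eq_two]; exact ENat.LEInfty.out)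
  have : IsManifold J 1 M := IsManifold.of_le (n := ∞) (by exact_mod_cast le_top)
  refine h.congr_of_eventuallyEq (Eventually.of_forall fun x => ?_)
  refine Eq.trans ?_ (inTangentCoordinates_eq (fun _ : N => p) (fun x => f x p)
    (fun x => diffAt J (f x) p) (I := J) (I' := 𝓘(ℝ, F)) (x₀ := x₀) (x := x)
    (mem_chart_source B p) (mem_univ _)).symm
  ext v
  rw [TangentBundle.coordChange_model_space]
  simp only [ContinuousLinearMap.comp_apply]
  rw [(tangentBundleCore J M).coordChange_self (achart B p) p (mem_chart_source B p) v]
  rfl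

end Parametric

end SubFinsler

/-! ### Left-invariant equations near the identity -/

namespace SubFinsler

section LieGroup

variable {E : Type*} [NormedAddCommGroup E] [NormedSpace ℝ E]
  {B : Type*} [TopologicalSpace B] {I : ModelWithCorners ℝ E B}
  {G : Type*} [TopologicalSpace G] [ChartedSpace B G]

theorem hasMFDerivAt_of_extChartAt [I.Boundaryless] [IsManifold I 1 G] {c : ℝ → G} {t : ℝ} {p : G}
    (hc : ContinuousAt c t) (hp : c t ∈ (extChartAt I p).source) {V : TangentSpace I (c t)}
    (hd : HasDerivAt (fun s => extChartAt I p (c s)) (diffAt I (extChartAt I p) (c t) V) t) :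
    HasMFDerivAt 𝓘(ℝ, ℝ) I c t ((1 : ℝ →L[ℝ] ℝ).smulRight V) := by
  have hinv := mfderivWithin_extChartAt_symm_comp_mfderiv_extChartAt' hp
  rw [I.range_eq_univ, mfderivWithin_univ] at hinv
  have hs : MDifferentiableAt 𝓘(ℝ, E) I (extChartAt I p).symm (extChartAt I p (c t)) := by
    have := mdifferentiableWithinAt_extChartAt_symm ((extChartAt I p).map_source hp)
    rwa [I.range_eq_univ, mdifferentiableWithinAt_univ] at this
  have h1 : HasMFDerivAt 𝓘(ℝ, ℝ) 𝓘(ℝ, E) (fun s => extChartAt I p (c s)) t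
      (ContinuousLinearMap.toSpanSingleton ℝ (diffAt I (extChartAt I p) (c t) V)) :=
    hasMFDerivAt_iff_hasFDerivAt.2 hd.hasFDerivAt
  have h2 := hs.hasMFDerivAt.comp t h1
  have h3 : HasMFDerivAt 𝓘(ℝ, ℝ) I c t _ := h2.congr_of_eventuallyEq (by
    filter_upwards [hc ((isOpen_extChartAt_source p).mem_nhds hp)] with s hs
    exact ((extChartAt I p).left_inv hs).symm)
  refine h3.congr_mfderiv ?_
  ext
  exact (congrArg (mfderiv 𝓘(ℝ, E) I (extChartAt I p).symm (extChartAt I p (c t)))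
    (one_smul ℝ (diffAt I (extChartAt I p) (c t) V))).trans
    ((congrArg (fun L : E →L[ℝ] E => L V) hinv).trans (one_smul ℝ V).symm)

variable [Group G]

variable (I) in
/-- The left-invariant vector field of `w`, an element of the model space `E` to which the Lie
algebra of `G` unfolds. -/
def leftField (w : E) (g : G) : TangentSpace I g :=
  mulInvariantVectorField (I := I) (G := G) w g

variable [LieGroup I ∞ G]

/-- The chain rule for a function of a left translate. -/
theorem diffAt_comp_mul_left {F : Type*} [NormedAddCommGroup F] [NormedSpace ℝ F] {f : G → F}
    {k : G} (hf : MDifferentiableAt I 𝓘(ℝ, F) f k) (w : E) :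
    diffAt I (fun s => f (k * s)) 1 w = diffAt I f k (leftField I w k) := by
  have h4 : HasMFDerivAt I 𝓘(ℝ, F) f (k * 1) (mfderiv I 𝓘(ℝ, F) f k) := by
    rw [mul_one]
    exact hf.hasMFDerivAt
  have h5 : HasMFDerivAt I I (fun s : G => k * s) 1 (mfderiv I I (fun s : G => k * s) 1) :=
    ((contMDiff_mul_left (I := I) (n := ∞) (a := k)).mdifferentiableAt (by simp)).hasMFDerivAt
  exact congrArg (fun L : E →L[ℝ] F => L w) (h4.comp (1 : G) h5).mfderiv

variable (I) in
/-- `g : [0,1] → G` is an absolutely continuous curve with left-invariant velocity `w`, that is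
`g'(t) = g(t) w(t)` for almost every `t`. -/
def HasLeftVelocity (w : ℝ → E) (g : ℝ → G) : Prop :=
  (∀ t ∈ Icc (0 : ℝ) 1, ACCurveAt I g t) ∧ ∀ᵐ t, t ∈ Icc (0 : ℝ) 1 →
    HasMFDerivAt 𝓘(ℝ, ℝ) I g t
      ((1 : ℝ →L[ℝ] ℝ).smulRight (leftField I (w t) (g t)))

variable (I) in
/-- The differential at `1` of `s ↦ κ (κ⁻¹ x * s)`, where `κ` is the chart at `1`: the
left-invariant vector fields of `G` in that chart. -/
def leftFieldInChart (G : Type*) [TopologicalSpace G] [ChartedSpace B G] [Group G] (x : E) :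
    E →L[ℝ] E :=
  diffAt I (fun s : G => extChartAt I (1 : G) ((extChartAt I (1 : G)).symm x * s)) 1

theorem contDiffAt_leftFieldInChart [I.Boundaryless] :
    ContDiffAt ℝ 1 (leftFieldInChart I G) (extChartAt I (1 : G) 1) := by
  rw [← contMDiffAt_iff_contDiffAt]
  have : IsManifold I ∞ G := inferInstance
  refine contMDiffAt_mfderiv_of_param
    (f := fun (x : E) (s : G) => extChartAt I (1 : G) ((extChartAt I (1 : G)).symm x * s)) ?_
  have h1 : ContMDiffAt 𝓘(ℝ, E) I ∞ (extChartAt I (1 : G)).symm (extChartAt I (1 : G) 1) :=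
    (contMDiffOn_extChartAt_symm (1 : G)).contMDiffAt (extChartAt_target_mem_nhds (1 : G))
  have h2 : ContMDiffAt (𝓘(ℝ, E).prod I) I ∞
      (fun q : E × G => (extChartAt I (1 : G)).symm q.1 * q.2) (extChartAt I (1 : G) 1, 1) :=
    (h1.comp (extChartAt I (1 : G) 1, (1 : G)) contMDiffAt_fst).mul contMDiffAt_snd
  refine ContMDiffAt.comp (extChartAt I (1 : G) 1, (1 : G)) (g := extChartAt I (1 : G)) ?_ h2
  rw [(extChartAt I (1 : G)).left_inv (mem_extChartAt_source (1 : G)), mul_one]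
  exact contMDiffAt_extChartAt

/-- Controls of small mass have a solution starting at `1`, which does not move while the control
vanishes. -/
theorem exists_hasLeftVelocity_of_small [I.Boundaryless] [FiniteDimensional ℝ E] :
    ∃ ε > 0, ∀ w : ℝ → E, Integrable w → ∫ s, ‖w s‖ ≤ ε →
      ∃ g : ℝ → G, HasLeftVelocity I w g ∧ g 0 = 1 ∧
        ∀ s t, (∀ τ ∈ uIoc s t, w τ = 0) → g t = g s := by
  set x₀ := extChartAt I (1 : G) 1 with hx₀
  obtain ⟨K, S, hS, hK⟩ := (contDiffAt_leftFieldInChart (I := I) (G := G)).exists_lipschitzOnWith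
  obtain ⟨ρ, hρ, hρS⟩ := Metric.mem_nhds_iff.1
    (inter_mem hS (extChartAt_target_mem_nhds (I := I) (1 : G)))
  obtain ⟨A, hA, hAeq⟩ := hK.extend_finite_dimension
  set K' := lipschitzExtensionConstant (E →L[ℝ] E) * K
  have : IsManifold I ∞ G := inferInstance
  have : IsManifold I 1 G := IsManifold.of_le (n := ∞) (by simp)
  have : CompleteSpace E := FiniteDimensional.complete ℝ E
  refine ⟨min (1 / (2 * (K' + 1))) (ρ / (4 * (‖A x₀‖ + 1))), by positivity, fun w hw hε => ?_⟩
  have hε0 : 0 ≤ ∫ s, ‖w s‖ := integral_nonneg fun s => norm_nonneg _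
  have hε1 : K' * ∫ s, ‖w s‖ ≤ 1 / 2 := by
    have h1 := hε.trans (min_le_left _ _)
    rw [le_div_iff₀ (by positivity)] at h1
    nlinarith
  have hε2 : ‖A x₀‖ * ∫ s, ‖w s‖ ≤ ρ / 4 := by
    have h1 := hε.trans (min_le_right _ _)
    rw [le_div_iff₀ (by positivity)] at h1
    nlinarith
  obtain ⟨x, hint, hx⟩ := exists_integral_solution hA hw hε1 x₀
  -- the solution stays in the ball where the extension `A` agrees with the vector fields
  have hball : ∀ t, x t ∈ Metric.ball x₀ ρ := by
    set c₀ : BoundedContinuousFunction ℝ E := BoundedContinuousFunction.const ℝ x₀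
    have hd : dist x c₀ ≤ ρ / 4 + (1 / 2) * dist x c₀ := by
      refine (BoundedContinuousFunction.dist_le (by positivity)).2 fun t => ?_
      have h1 : ∀ s, ‖A (x s) (w s)‖ ≤ (‖A x₀‖ + K' * dist x c₀) * ‖w s‖ := fun s => by
        refine ContinuousLinearMap.le_of_opNorm_le _ ?_ _
        have h2 := hA.dist_le_mul (x s) x₀
        rw [dist_eq_norm] at h2
        have h3 : ‖A (x s)‖ ≤ ‖A x₀‖ + ‖A (x s) - A x₀‖ := by
          simpa using norm_add_le (A x₀) (A (x s) - A x₀)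
        have h4 : (K' : ℝ) * dist (x s) x₀ ≤ K' * dist x c₀ := by
          gcongr
          exact BoundedContinuousFunction.dist_coe_le_dist (f := x) (g := c₀) s
        linarith
      have h5 := norm_intervalIntegral_le_of_norm_le (by positivity) hw h1 0 t
      have h6 : dist (x t) (c₀ t) = ‖∫ s in (0 : ℝ)..t, A (x s) (w s)‖ := by
        rw [hx t, dist_eq_norm]
        simp [c₀]
      rw [h6]
      nlinarith [dist_nonneg (x := x) (y := c₀)]
    intro t
    have := BoundedContinuousFunction.dist_coe_le_dist (f := x) (g := c₀) t
    rw [Metric.mem_ball]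
    change dist (x t) x₀ ≤ dist x c₀ at this
    linarith
  have htgt : ∀ t, x t ∈ (extChartAt I (1 : G)).target := fun t => (hρS (hball t)).2
  have hcont : Continuous fun t => (extChartAt I (1 : G)).symm (x t) :=
    (continuousOn_extChartAt_symm (1 : G)).comp_continuous x.continuous htgt
  refine ⟨fun t => (extChartAt I (1 : G)).symm (x t), ⟨fun t ht => ?_, ?_⟩, ?_, ?_⟩
  · have hxac : ACCurveAt 𝓘(ℝ, E) x t := by
      refine ⟨x.continuous.continuousWithinAt, univ, univ_mem, fun a b _ _ => ?_⟩
      refine (absolutelyContinuousOnInterval_integral hint x₀ a b).congr fun s _ => ?_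
      exact hx s
    refine hxac.comp ?_
    exact ((contMDiffOn_extChartAt_symm (n := 1) (1 : G)).contMDiffAt
      ((isOpen_extChartAt_target (1 : G)).mem_nhds (htgt t)))
  · filter_upwards [LocallyIntegrable.ae_hasDerivAt_integral hint.locallyIntegrable] with t ht _
    have hdx : HasDerivAt x (A (x t) (w t)) t := by
      have h1 := (ht 0).const_add x₀
      rwa [show (fun t => x₀ + ∫ s in (0 : ℝ)..t, A (x s) (w s)) = x from
        funext fun t => (hx t).symm] at h1
    have hsrc : (extChartAt I (1 : G)).symm (x t) ∈ (extChartAt I (1 : G)).source :=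
      (extChartAt I (1 : G)).map_target (htgt t)
    refine hasMFDerivAt_of_extChartAt (p := 1) hcont.continuousAt hsrc ?_
    rw [← diffAt_comp_mul_left (mdifferentiableAt_extChartAt
      (by rwa [extChartAt_source] at hsrc))]
    have h2 : (fun s => extChartAt I (1 : G) ((extChartAt I (1 : G)).symm (x s))) = x :=
      funext fun s => (extChartAt I (1 : G)).right_inv (htgt s)
    rw [h2]
    rw [← hAeq (hρS (hball t)).1] at hdx
    exact hdx
  · have : x 0 = x₀ := by rw [hx 0]; simp
    simp only [this, hx₀]
    exact (extChartAt I (1 : G)).left_inv (mem_extChartAt_source (1 : G))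
  · intro s t hst
    have : x t = x s := by
      rw [hx t, hx s, add_right_inj, ← sub_eq_zero,
        intervalIntegral.integral_interval_sub_left hint.intervalIntegrable
          hint.intervalIntegrable]
      refine intervalIntegral.integral_zero_ae (Eventually.of_forall fun τ hτ => ?_)
      rw [hst τ hτ, map_zero]
    simp only [this]

end LieGroup

end SubFinsler

/-! ### Global solutions of left-invariant equations -/

namespace SubFinsler

section Gluing

variable {E : Type*} [NormedAddCommGroup E] [NormedSpace ℝ E]
  {B : Type*} [TopologicalSpace B] {I : ModelWithCorners ℝ E B}
  {G : Type*} [TopologicalSpace G] [ChartedSpace B G] [Group G]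

theorem leftField_zero (g : G) : leftField I (0 : E) g = 0 :=
  map_zero (mfderiv I I (fun s : G => g * s) 1)

theorem hasMFDerivAt_leftField_congr {w : E} {t : ℝ} {g g' : ℝ → G}
    (h : HasMFDerivAt 𝓘(ℝ, ℝ) I g t ((1 : ℝ →L[ℝ] ℝ).smulRight (leftField I w (g t))))
    (hg : g' =ᶠ[𝓝 t] g) :
    HasMFDerivAt 𝓘(ℝ, ℝ) I g' t ((1 : ℝ →L[ℝ] ℝ).smulRight (leftField I w (g' t))) := by
  refine (h.congr_of_eventuallyEq hg).congr_mfderiv ?_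
  exact congrArg (fun p : G => ((1 : ℝ →L[ℝ] ℝ).smulRight (leftField I w p : E) : ℝ →L[ℝ] E))
    hg.eq_of_nhds.symm

variable [LieGroup I ∞ G]

theorem mfderiv_mul_left_leftField (a k : G) (w : E) :
    (mfderiv I I (fun s : G => a * s) k (leftField I w k) : E) = leftField I w (a * k) := by
  have hL : ∀ g x : G, MDifferentiableAt I I (fun y : G => g * y) x := fun g x =>
    (contMDiff_mul_left (I := I) (n := ∞) (a := g)).mdifferentiableAt (by simp)
  have h1 : (fun y : G => a * k * y) = (fun y : G => a * y) ∘ (fun y : G => k * y) := by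
    funext y
    simp [mul_assoc]
  have h2 : HasMFDerivAt I I (fun y : G => a * y) (k * 1)
      (mfderiv I I (fun y : G => a * y) k) := by
    rw [mul_one]
    exact (hL a k).hasMFDerivAt
  have h3 := h2.comp (1 : G) (hL k 1).hasMFDerivAt
  rw [← h1] at h3
  exact (congrArg (fun L : E →L[ℝ] E => L w) h3.mfderiv).symm

theorem hasMFDerivAt_const_mul_leftField {w : E} {t : ℝ} {k : ℝ → G}
    (h : HasMFDerivAt 𝓘(ℝ, ℝ) I k t ((1 : ℝ →L[ℝ] ℝ).smulRight (leftField I w (k t)))) (a : G) :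
    HasMFDerivAt 𝓘(ℝ, ℝ) I (fun s => a * k s) t
      ((1 : ℝ →L[ℝ] ℝ).smulRight (leftField I w (a * k t))) := by
  have hL : MDifferentiableAt I I (fun y : G => a * y) (k t) :=
    (contMDiff_mul_left (I := I) (n := ∞) (a := a)).mdifferentiableAt (by simp)
  refine (hL.hasMFDerivAt.comp t h).congr_mfderiv ?_
  ext
  exact (congrArg (mfderiv I I (fun y : G => a * y) (k t)) (one_smul ℝ (leftField I w (k t)))).trans
    ((mfderiv_mul_left_leftField a (k t) w).trans (one_smul ℝ (leftField I w (a * k t))).symm)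

/-- A partition of `[0,1]` into intervals on which an integrable function has small mass. -/
theorem exists_partition_integral_le {f : ℝ → ℝ} (hf : Integrable f) {ε : ℝ} (hε : 0 < ε) :
    ∃ N : ℕ, 0 < N ∧ ∀ j : ℕ, j < N →
      ∫ s in ((j : ℝ) / N)..((j + 1 : ℝ) / N), f s ≤ ε := by
  have hc : Continuous fun t => ∫ s in (0 : ℝ)..t, f s :=
    intervalIntegral.continuous_primitive (fun a b => hf.intervalIntegrable) 0
  have hu := isCompact_Icc.uniformContinuousOn_of_continuous (hc.continuousOn (s := Icc (0 : ℝ) 1))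
  obtain ⟨δ, hδ, hδε⟩ := Metric.uniformContinuousOn_iff.1 hu ε hε
  obtain ⟨n, hn⟩ := exists_nat_one_div_lt hδ
  refine ⟨n + 1, n.succ_pos, fun j hj => ?_⟩
  have hN : (0 : ℝ) < ((n + 1 : ℕ) : ℝ) := by positivity
  have hj' : (j : ℝ) + 1 ≤ ((n + 1 : ℕ) : ℝ) := by exact_mod_cast hj
  have h := hδε (((j : ℝ) + 1) / (n + 1 : ℕ)) ⟨by positivity, by rw [div_le_one hN]; exact hj'⟩
    ((j : ℝ) / (n + 1 : ℕ)) ⟨by positivity, by rw [div_le_one hN]; linarith⟩ (by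
      rw [Real.dist_eq, ← sub_div, add_sub_cancel_left, abs_of_pos (by positivity)]
      exact_mod_cast hn)
  rw [Real.dist_eq, intervalIntegral.integral_interval_sub_left hf.intervalIntegrable
    hf.intervalIntegrable] at h
  exact (le_abs_self _).trans h.le

/-- Every integrable control has a solution on `[0,1]` starting at `1`: the solutions on short
intervals are glued by left translations. -/
theorem exists_hasLeftVelocity [I.Boundaryless] [FiniteDimensional ℝ E] {w : ℝ → E}
    (hw : Integrable w) : ∃ g : ℝ → G, HasLeftVelocity I w g ∧ g 0 = 1 := by
  obtain ⟨ε, hε, hsol⟩ := exists_hasLeftVelocity_of_small (I := I) (G := G)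
  obtain ⟨N, hN, hNε⟩ := exists_partition_integral_le hw.norm hε
  have hN' : (0 : ℝ) < N := by exact_mod_cast hN
  have : IsManifold I 1 G := IsManifold.of_le (n := ∞) (by simp)
  have key : ∀ j : ℕ, j ≤ N → ∃ g : ℝ → G,
      HasLeftVelocity I ((Iic ((j : ℝ) / N)).indicator w) g ∧ g 0 = 1 ∧
        ∀ t, (j : ℝ) / N ≤ t → g t = g ((j : ℝ) / N) := by
    intro j
    induction j with
    | zero =>
      intro _
      refine ⟨fun _ => 1, ⟨fun t _ => ⟨continuousWithinAt_const, univ, univ_mem, fun a b _ _ =>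
        (LipschitzWith.const _).lipschitzOnWith.absolutelyContinuousOnInterval⟩, ?_⟩, rfl,
        fun _ _ => rfl⟩
      filter_upwards [compl_mem_ae_iff.2 (measure_singleton (0 : ℝ))] with t ht0 ht
      have ht1 : 0 < t := lt_of_le_of_ne ht.1 (Ne.symm ht0)
      rw [indicator_of_notMem (by simpa using ht1), leftField_zero]
      refine (hasMFDerivAt_const (1 : G) t).congr_mfderiv ?_
      ext
      exact (smul_zero _).symm
    | succ j ih =>
      intro hj
      obtain ⟨g, hg, hg0, hgc⟩ := ih (by lia)
      have hle : (j : ℝ) / N ≤ (j + 1 : ℝ) / N := by gcongr; linarith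
      have hj0 : (0 : ℝ) ≤ (j : ℝ) / N := by positivity
      obtain ⟨k, hk, hk0, hkc⟩ := hsol ((Ioc ((j : ℝ) / N) ((j + 1 : ℝ) / N)).indicator w)
        (hw.indicator measurableSet_Ioc) (by
          have := hNε j (by lia)
          rw [intervalIntegral.integral_of_le hle] at this
          simp_rw [norm_indicator_eq_indicator_norm]
          rwa [integral_indicator measurableSet_Ioc])
      have hk1 : ∀ t ≤ (j : ℝ) / N, k t = 1 := fun t ht => by
        rw [← hk0]
        refine hkc 0 t fun τ hτ => indicator_of_notMem (fun h => ?_) _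
        have : τ ≤ max 0 t := hτ.2
        exact absurd (this.trans (max_le hj0 ht)) (not_le.2 h.1)
      refine ⟨fun t => g t * k t, ⟨fun t ht => ?_, ?_⟩, ?_, ?_⟩
      · exact ((hg.1 t ht).prodMk (hk.1 t ht)).comp (F := fun q : G × G => q.1 * q.2)
          (contMDiff_mul I 1).contMDiffAt
      · filter_upwards [hg.2, hk.2, compl_mem_ae_iff.2 (measure_singleton ((j : ℝ) / N))]
          with t hgt hkt htj ht
        rcases lt_or_gt_of_ne (show t ≠ (j : ℝ) / N from htj) with h | h
        · have hw1 : (Iic (((j + 1 : ℕ) : ℝ) / N)).indicator w t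
              = (Iic ((j : ℝ) / N)).indicator w t := by
            push_cast
            rw [indicator_of_mem (show t ∈ Iic _ from h.le.trans hle),
              indicator_of_mem (show t ∈ Iic _ from h.le)]
          rw [hw1]
          refine hasMFDerivAt_leftField_congr (hgt ht) ?_
          filter_upwards [Iio_mem_nhds h] with s hs
          rw [hk1 s (le_of_lt hs), mul_one]
        · have hw1 : (Iic (((j + 1 : ℕ) : ℝ) / N)).indicator w t
              = (Ioc ((j : ℝ) / N) ((j + 1 : ℝ) / N)).indicator w t := by
            push_cast
            simp only [indicator, mem_Iic, mem_Ioc, h, true_and]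
          rw [hw1]
          refine hasMFDerivAt_leftField_congr (hasMFDerivAt_const_mul_leftField (hkt ht)
            (g ((j : ℝ) / N))) ?_
          filter_upwards [Ioi_mem_nhds h] with s hs
          rw [hgc s (le_of_lt hs)]
      · simp only [hg0, hk0, mul_one]
      · intro t ht
        push_cast at ht ⊢
        have h1 : k t = k ((j + 1 : ℝ) / N) := by
          refine hkc _ _ fun τ hτ => indicator_of_notMem (fun h => ?_) _
          have : min ((j + 1 : ℝ) / N) t < τ := hτ.1
          rw [min_eq_left ht] at this
          exact absurd h.2 (not_le.2 this)
        rw [h1, hgc t (hle.trans ht), hgc _ hle]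
  obtain ⟨g, hg, hg0, -⟩ := key N le_rfl
  refine ⟨g, ⟨hg.1, ?_⟩, hg0⟩
  filter_upwards [hg.2] with t h ht
  have h1 := h ht
  rwa [div_self hN'.ne', indicator_of_mem (show t ∈ Iic 1 from ht.2)] at h1

end Gluing

end SubFinsler

/-! ### Submersions and the action on `H \ G` -/

namespace SubFinsler

section Submersion

variable {E : Type*} [NormedAddCommGroup E] [NormedSpace ℝ E]
  {B : Type*} [TopologicalSpace B] {I : ModelWithCorners ℝ E B} [I.Boundaryless]
  {G : Type*} [TopologicalSpace G] [ChartedSpace B G]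
  {E' : Type*} [NormedAddCommGroup E'] [NormedSpace ℝ E']
  {B' : Type*} [TopologicalSpace B'] {J : ModelWithCorners ℝ E' B'}
  {M : Type*} [TopologicalSpace M] [ChartedSpace B' M]

/-- A submersion has a smooth local section through every point. -/
theorem exists_section_of_isSubmersionAt {f : G → M} {x : G}
    (h : Manifold.IsSubmersionAt I J ∞ f x) :
    ∃ σ : M → G, ContMDiffAt J I ∞ σ (f x) ∧ σ (f x) = x ∧ ∀ᶠ y in 𝓝 (f x), f (σ y) = y := by
  set κ := h.domChart.extend I with hκ
  set θ := h.codChart.extend J with hθ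
  set L := h.equiv
  have hxs : x ∈ κ.source := by
    rw [hκ, OpenPartialHomeomorph.extend_source]; exact h.mem_domChart_source
  have hfx : f x ∈ h.codChart.source := h.mem_codChart_source
  let τ : M → E := fun y => L.symm (θ y, (L (κ x)).2)
  have hw : ∀ z ∈ κ.target, θ (f (κ.symm z)) = (L z).1 := h.writtenInCharts
  have hτx : τ (f x) = κ x := by
    have h1 := hw _ (κ.map_source hxs)
    rw [κ.left_inv hxs] at h1
    simp only [τ]
    rw [h1]
    exact L.symm_apply_apply (κ x)
  have hτ : ContMDiffAt J 𝓘(ℝ, E) ∞ τ (f x) := by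
    have h1 : ContMDiffAt J 𝓘(ℝ, E') ∞ θ (f x) :=
      h.codChart.contMDiffAt_extend h.codChart_mem_maximalAtlas hfx
    have h2 : ContMDiffAt J 𝓘(ℝ, E' × h.complement) ∞ (fun y => (θ y, (L (κ x)).2)) (f x) :=
      h1.prodMk_space contMDiffAt_const
    exact L.symm.contDiff.contMDiff.contMDiffAt.comp (f x) h2
  have htgt : κ.target ∈ 𝓝 (κ x) := by
    have : κ.target ∈ 𝓝[range I] κ x :=
      h.domChart.extend_target_mem_nhdsWithin h.mem_domChart_source
    rwa [I.range_eq_univ, nhdsWithin_univ] at this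
  refine ⟨fun y => κ.symm (τ y), ?_, ?_, ?_⟩
  · have h3 : ContMDiffAt 𝓘(ℝ, E) I ∞ κ.symm (τ (f x)) := by
      rw [hτx]
      refine (contMDiffOn_extend_symm h.domChart_mem_maximalAtlas).contMDiffAt ?_
      rw [← OpenPartialHomeomorph.extend_target']
      exact htgt
    exact h3.comp (f x) hτ
  · simp only [hτx]
    exact κ.left_inv hxs
  · have h4 : ∀ᶠ y in 𝓝 (f x), τ y ∈ κ.target :=
      hτ.continuousAt (by rw [hτx]; exact htgt)
    filter_upwards [h4, h.codChart.open_source.mem_nhds hfx] with y hy hys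
    have h5 := hw _ hy
    have h6 : (L (τ y)).1 = θ y := by simp [τ]
    rw [h6] at h5
    refine θ.injOn ?_ ?_ h5
    · rw [hθ, OpenPartialHomeomorph.extend_source]
      refine h.source_subset_preimage_source ?_
      have := κ.map_target hy
      rwa [hκ, OpenPartialHomeomorph.extend_source] at this
    · rw [hθ, OpenPartialHomeomorph.extend_source]
      exact hys

end Submersion

end SubFinsler

namespace Carnot

open SubFinsler

section Action

variable {n k : ℕ} {G : Type*} [Group G] (H : Subgroup G)

theorem proj_eq_iff {x y : G} : proj H x = proj H y ↔ y * x⁻¹ ∈ H := by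
  rw [← QuotientGroup.rightRel_apply]
  exact Quotient.eq (r := QuotientGroup.rightRel H)

/-- The right action of `G` on `H \ G`: `(H q, x) ↦ H (q x)`. -/
def act (p : RightQuotient H) (x : G) : RightQuotient H :=
  proj H (p.out * x)

theorem proj_out (p : RightQuotient H) : proj H p.out = p := Quotient.out_eq p

theorem act_proj (q x : G) : act H (proj H q) x = proj H (q * x) := by
  have h := (proj_eq_iff H).1 (proj_out H (proj H q))
  refine (proj_eq_iff H).2 ?_
  convert h using 1
  group

theorem act_act (p : RightQuotient H) (x y : G) : act H (act H p x) y = act H p (x * y) := by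
  obtain ⟨q, rfl⟩ : ∃ q, proj H q = p := ⟨_, proj_out H p⟩
  rw [act_proj, act_proj, act_proj, mul_assoc]

theorem act_one (p : RightQuotient H) : act H p 1 = p := by
  rw [act, mul_one, proj_out]

variable [TopologicalSpace G] [ChartedSpace (EuclideanSpace ℝ (Fin n)) G] [LieGroup (𝓡 n) ∞ G]
  [ChartedSpace (EuclideanSpace ℝ (Fin k)) (RightQuotient H)]

/-- The right action on `H \ G` is smooth, because the projection has smooth local sections. -/
theorem contMDiff_act [IsManifold (𝓡 k) ∞ (RightQuotient H)]
    (hproj : Manifold.IsSubmersion (𝓡 n) (𝓡 k) ∞ (proj H)) :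
    ContMDiff ((𝓡 k).prod (𝓡 n)) (𝓡 k) ∞ (fun z : RightQuotient H × G => act H z.1 z.2) := by
  rintro ⟨p, x⟩
  obtain ⟨q, rfl⟩ : ∃ q, proj H q = p := ⟨_, proj_out H p⟩
  obtain ⟨σ, hσ, -, hπσ⟩ := exists_section_of_isSubmersionAt (hproj.isSubmersionAt q)
  have h1 : ContMDiffAt ((𝓡 k).prod (𝓡 n)) (𝓡 n) ∞ (fun z : RightQuotient H × G => σ z.1 * z.2)
      (proj H q, x) :=
    (hσ.comp (proj H q, x) contMDiffAt_fst).mul contMDiffAt_snd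
  have h2 := (hproj.contMDiff _).comp (proj H q, x) h1
  refine h2.congr_of_eventuallyEq ?_
  filter_upwards [continuousAt_fst.eventually hπσ] with z hz
  rw [Function.comp_apply, ← act_proj, hz]

/-- The map `(H q, x) ↦ H (q x⁻¹)` is constant along the diagonal motion by a left-invariant
field. -/
theorem apply_projField_leftField_eq_zero
    (hproj : Manifold.IsSubmersion (𝓡 n) (𝓡 k) ∞ (proj H)) (w : EuclideanSpace ℝ (Fin n))
    (p : RightQuotient H) (x : G)
    (D : EuclideanSpace ℝ (Fin k) × EuclideanSpace ℝ (Fin n) →L[ℝ] EuclideanSpace ℝ (Fin k))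
    (hD : HasMFDerivAt ((𝓡 k).prod (𝓡 n)) (𝓡 k)
      (fun z : RightQuotient H × G => act H z.1 z.2⁻¹) (p, x) D) :
    D (projField H w p, leftField (𝓡 n) w x) = 0 := by
  obtain ⟨q, rfl⟩ : ∃ q, proj H q = p := ⟨_, proj_out H p⟩
  have hL : ∀ g y : G, MDifferentiableAt (𝓡 n) (𝓡 n) (fun y : G => g * y) y := fun g x =>
    (contMDiff_mul_left (I := 𝓡 n) (n := ∞) (a := g)).mdifferentiableAt (by simp)
  have hπ : MDifferentiable (𝓡 n) (𝓡 k) (proj H) := hproj.contMDiff.mdifferentiable (by simp)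
  have h1 : HasMFDerivAt (𝓡 n) (𝓡 k) (proj H) (q * 1) (mfderiv (𝓡 n) (𝓡 k) (proj H) q) := by
    rw [mul_one]
    exact (hπ q).hasMFDerivAt
  have h2 := (h1.comp (1 : G) (hL q 1).hasMFDerivAt).prodMk (hL x 1).hasMFDerivAt
  have h3 : HasMFDerivAt ((𝓡 k).prod (𝓡 n)) (𝓡 k)
      (fun z : RightQuotient H × G => act H z.1 z.2⁻¹) (proj H (q * 1), x * 1) D := by
    rw [mul_one, mul_one]
    exact hD
  have h4 := h3.comp (1 : G) h2
  have h5 : (fun z : RightQuotient H × G => act H z.1 z.2⁻¹) ∘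
      (fun s : G => ((proj H ∘ fun y : G => q * y) s, x * s)) = fun _ => proj H (q * x⁻¹) := by
    funext s
    simp only [Function.comp_apply, act_proj]
    congr 1
    group
  have h6 : HasMFDerivAt (𝓡 n) (𝓡 k) (fun _ : G => proj H (q * x⁻¹)) 1 _ := h5 ▸ h4
  have h7 := h6.mfderiv.symm.trans mfderiv_const
  rw [projField_proj H hπ w q]
  exact congrArg (fun T : EuclideanSpace ℝ (Fin n) →L[ℝ] EuclideanSpace ℝ (Fin k) => T w) h7

/-- If `g` solves the left-invariant equation of `w` with `g 0 = 1`, then a curve of `H \ G` whose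
velocity is the projection of the field of `w` is `t ↦ p 0 · g t`. -/
theorem eq_act_of_velocity [IsManifold (𝓡 k) ∞ (RightQuotient H)]
    (hproj : Manifold.IsSubmersion (𝓡 n) (𝓡 k) ∞ (proj H))
    {w : ℝ → EuclideanSpace ℝ (Fin n)} {g : ℝ → G} (hg : HasLeftVelocity (𝓡 n) w g)
    (hg0 : g 0 = 1) {p : ℝ → RightQuotient H}
    (hp : ∀ t ∈ Icc (0 : ℝ) 1, ACCurveAt (𝓡 k) p t)
    (hpv : ∀ᵐ t, t ∈ Icc (0 : ℝ) 1 → HasMFDerivAt 𝓘(ℝ, ℝ) (𝓡 k) p t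
      ((1 : ℝ →L[ℝ] ℝ).smulRight (projField (n := n) H (w t) (p t)))) :
    ∀ t ∈ Icc (0 : ℝ) 1, p t = act H (p 0) (g t) := by
  have hA : ContMDiff ((𝓡 k).prod (𝓡 n)) (𝓡 k) ∞
      (fun z : RightQuotient H × G => act H z.1 z.2⁻¹) :=
    (contMDiff_act H hproj).comp (contMDiff_fst.prodMk contMDiff_snd.inv)
  have : IsManifold (𝓡 k) 1 (RightQuotient H) := IsManifold.of_le (n := ∞) (by simp)
  have key := eq_of_acCurveAt_of_velocity_zero (J := 𝓡 k) (c := fun t => act H (p t) (g t)⁻¹)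
    (fun t ht => ((hp t ht).prodMk (hg.1 t ht)).comp
      (F := fun z : RightQuotient H × G => act H z.1 z.2⁻¹) (hA.contMDiffAt.of_le (by simp))) (by
      filter_upwards [hpv, hg.2] with t h1 h2 ht
      obtain ⟨D, hD⟩ : ∃ D : EuclideanSpace ℝ (Fin k) × EuclideanSpace ℝ (Fin n) →L[ℝ]
          EuclideanSpace ℝ (Fin k), HasMFDerivAt ((𝓡 k).prod (𝓡 n)) (𝓡 k)
            (fun z : RightQuotient H × G => act H z.1 z.2⁻¹) (p t, g t) D :=
        ⟨_, (hA.mdifferentiableAt (by simp) (x := (p t, g t))).hasMFDerivAt⟩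
      refine (hD.comp t ((h1 ht).prodMk (h2 ht))).congr_mfderiv ?_
      have h4 := apply_projField_leftField_eq_zero H hproj (w t) (p t) (g t) D hD
      ext1
      exact ((congrArg D (Prod.ext (one_smul ℝ (projField (n := n) H (w t) (p t)))
        (one_smul ℝ (leftField (𝓡 n) (w t) (g t))))).trans h4).trans
        (smul_zero (1 : ℝ) : (1 : ℝ) • (0 : EuclideanSpace ℝ (Fin k)) = 0).symm)
  intro t ht
  have h := key t ht
  simp only [hg0, inv_one, act_one] at h
  rw [← h, act_act, inv_mul_cancel, act_one]

end Action

end Carnot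

/-! ### First variation under the dilations -/

namespace SubFinsler

section Integrability

variable {E : Type*} [NormedAddCommGroup E] [NormedSpace ℝ E]

theorem integrableOn_clm_apply {A : ℝ → E →L[ℝ] ℝ} (hA : ContinuousOn A (Icc 0 1)) {w : ℝ → E}
    (hw : Integrable w) : IntegrableOn (fun s => A s (w s)) (Icc 0 1) := by
  obtain ⟨C, hC⟩ := isCompact_Icc.exists_bound_of_continuousOn hA
  refine Integrable.mono' ((hw.norm.const_mul C).integrableOn) ?_ ?_
  · exact isBoundedBilinearMap_apply.continuous.comp_aestronglyMeasurable₂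
      (hA.aestronglyMeasurable measurableSet_Icc) hw.1.restrict
  · filter_upwards [ae_restrict_mem measurableSet_Icc] with s hs
    exact (A s).le_of_opNorm_le (hC s hs) _

end Integrability

section Dilation

variable {E : Type*} [NormedAddCommGroup E] [NormedSpace ℝ E]
  {B : Type*} [TopologicalSpace B] {I : ModelWithCorners ℝ E B}
  {G : Type*} [TopologicalSpace G] [ChartedSpace B G] [Group G]

variable (I) in
/-- The linear form `w ↦ d/ds h (y · g exp(s w) g⁻¹)` at `s = 0`, that is the derivative of `h` at
`y` along the left-invariant field of `Ad g w`. -/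
def conjDiff (h : G → ℝ) (z : G × G) : E →L[ℝ] ℝ :=
  diffAt I (fun s => h (z.1 * (z.2 * s * z.2⁻¹))) 1

theorem HasLeftVelocity.continuousOn {w : ℝ → E} {g : ℝ → G} (hg : HasLeftVelocity I w g) :
    ContinuousOn g (Icc 0 1) := fun t ht => (hg.1 t ht).1

theorem norm_integral_conjDiff_le {h : G → ℝ} {C : ℝ} (hC0 : 0 ≤ C) {w : ℝ → E}
    (hw : Integrable w) {z : ℝ → G × G} (hC : ∀ s ∈ Icc (0 : ℝ) 1, ‖conjDiff I h (z s)‖ ≤ C)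
    {t : ℝ} (ht : t ∈ Icc (0 : ℝ) 1) :
    ‖∫ s in (0 : ℝ)..t, conjDiff I h (z s) (w s)‖ ≤ C * ∫ s, ‖w s‖ := by
  refine (intervalIntegral.norm_integral_le_of_norm_le (g := fun s => C * ‖w s‖) ht.1
    (Eventually.of_forall fun s hs => (conjDiff I h (z s)).le_of_opNorm_le
      (hC s ⟨hs.1.le, hs.2.trans ht.2⟩) _) (hw.norm.const_mul C).intervalIntegrable).trans ?_
  rw [← integral_const_mul, intervalIntegral.integral_of_le ht.1]
  exact setIntegral_le_integral (hw.norm.const_mul C) (Eventually.of_forall fun s => by positivity)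

variable [LieGroup I ∞ G]

theorem continuous_conjDiff {h : G → ℝ} (hh : ContMDiff I 𝓘(ℝ, ℝ) ∞ h) :
    Continuous (conjDiff I h) := by
  have h1 : ContMDiff (I.prod I) 𝓘(ℝ, E →L[ℝ] ℝ) 1 (conjDiff I h) := fun z => by
    refine contMDiffAt_mfderiv_of_param
      (f := fun (z : G × G) (s : G) => h (z.1 * (z.2 * s * z.2⁻¹))) ?_
    have h2 : ContMDiff ((I.prod I).prod I) I ∞
        (fun q : (G × G) × G => q.1.1 * (q.1.2 * q.2 * q.1.2⁻¹)) :=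
      (contMDiff_fst.comp contMDiff_fst).mul (((contMDiff_snd.comp contMDiff_fst).mul
        contMDiff_snd).mul (contMDiff_snd.comp contMDiff_fst).inv)
    exact (hh.comp h2).contMDiffAt
  exact h1.continuous

theorem conjDiff_eq_zero {h : G → ℝ} {z : G × G} (hz : z.1 ∉ tsupport h) : conjDiff I h z = 0 := by
  have : IsTopologicalGroup G := topologicalGroup_of_lieGroup I ∞
  have h0 : h =ᶠ[𝓝 (z.1 * (z.2 * 1 * z.2⁻¹))] 0 := by
    rw [mul_one, mul_inv_cancel, mul_one]
    exact notMem_tsupport_iff_eventuallyEq.1 hz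
  have hc : Continuous fun s : G => z.1 * (z.2 * s * z.2⁻¹) := by fun_prop
  have h1 : (fun s : G => h (z.1 * (z.2 * s * z.2⁻¹))) =ᶠ[𝓝 1] fun _ => (0 : ℝ) :=
    hc.continuousAt.eventually h0
  exact (h1.mfderiv_eq).trans mfderiv_const

theorem exists_bound_conjDiff {h : G → ℝ} (hh : ContMDiff I 𝓘(ℝ, ℝ) ∞ h)
    (hsupp : HasCompactSupport h) {K : Set G} (hK : IsCompact K) :
    ∃ C, 0 ≤ C ∧ ∀ y, ∀ g ∈ K, ‖conjDiff I h (y, g)‖ ≤ C := by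
  obtain ⟨C, hC⟩ := (IsCompact.prod hsupp hK).exists_bound_of_continuousOn
    (continuous_conjDiff hh).continuousOn
  refine ⟨max C 0, le_max_right _ _, fun y g hg => ?_⟩
  by_cases hy : y ∈ tsupport h
  · exact (hC (y, g) ⟨hy, hg⟩).trans (le_max_left _ _)
  · rw [conjDiff_eq_zero hy, norm_zero]
    exact le_max_right _ _

/-- If the differential at `1` of the endomorphism `δ` multiplies `w` by `r`, then the derivative
of `a ↦ δ(a) a⁻¹` along the left-invariant field of `w` is `r - 1` times a conjugate of `w`. -/
theorem diffAt_dilation {h : G → ℝ} (hh : ContMDiff I 𝓘(ℝ, ℝ) ∞ h) {δ : G →* G}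
    (hδ : ContMDiff I I ∞ δ) {r : ℝ} {w : E} (hδw : (mfderiv I I δ 1 w : E) = r • w) (a : G) :
    diffAt I (fun x => h (δ x * x⁻¹)) a (leftField I w a)
      = (r - 1) * conjDiff I h (δ a * a⁻¹, a) w := by
  have hF : ContMDiff I 𝓘(ℝ, ℝ) ∞ (fun x => h (δ x * x⁻¹)) :=
    hh.comp (hδ.mul contMDiff_id.inv)
  rw [← diffAt_comp_mul_left (hF.mdifferentiableAt (by simp))]
  -- the function of two variables whose restrictions to the graph of `δ`, to the first axis and to
  -- the diagonal are respectively the left-hand side, the right-hand side and a constant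
  let Q : G × G → ℝ := fun z => h (δ a * z.1 * z.2⁻¹ * a⁻¹)
  have hQ : ContMDiff (I.prod I) 𝓘(ℝ, ℝ) ∞ Q :=
    hh.comp (((contMDiff_const.mul contMDiff_fst).mul contMDiff_snd.inv).mul contMDiff_const)
  obtain ⟨D, hD⟩ : ∃ D : E × E →L[ℝ] ℝ, HasMFDerivAt (I.prod I) 𝓘(ℝ, ℝ) Q (1, 1) D :=
    ⟨_, (hQ.mdifferentiableAt (by simp) (x := (1, 1))).hasMFDerivAt⟩
  have hid : HasMFDerivAt I I (fun s : G => s) 1 (ContinuousLinearMap.id ℝ E) := hasMFDerivAt_id 1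
  have hδ1 : HasMFDerivAt I I δ 1 (mfderiv I I δ 1) :=
    (hδ.mdifferentiableAt (by simp)).hasMFDerivAt
  have h1 : diffAt I (fun s => h (δ (a * s) * (a * s)⁻¹)) 1 w = D (r • w, w) := by
    have hD' : HasMFDerivAt (I.prod I) 𝓘(ℝ, ℝ) Q (δ 1, 1) D := by rwa [map_one]
    have h2 := HasMFDerivAt.comp (f := fun s : G => (δ s, s)) (1 : G) hD' (hδ1.prodMk hid)
    have h3 : (fun s => h (δ (a * s) * (a * s)⁻¹)) = Q ∘ fun s => (δ s, s) := by
      funext s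
      simp [Q, mul_assoc]
    rw [h3, ← hδw]
    exact congrArg (fun L : E →L[ℝ] ℝ => L w) h2.mfderiv
  have h2 : conjDiff I h (δ a * a⁻¹, a) w = D (w, 0) := by
    have h2 := HasMFDerivAt.comp (f := fun s : G => (s, (1 : G))) (1 : G) hD
      (hid.prodMk (hasMFDerivAt_const (1 : G) (1 : G)))
    have h3 : (fun s => h (δ a * a⁻¹ * (a * s * a⁻¹))) = Q ∘ fun s => (s, 1) := by
      funext s
      simp [Q, mul_assoc]
    rw [conjDiff, h3]
    exact congrArg (fun L : E →L[ℝ] ℝ => L w) h2.mfderiv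
  have h3 : D (w, w) = 0 := by
    have h2 := HasMFDerivAt.comp (f := fun s : G => (s, s)) (1 : G) hD (hid.prodMk hid)
    have h3 : Q ∘ (fun s => (s, s)) = fun _ => h (δ a * a⁻¹) := by
      funext s
      simp [Q]
    rw [h3] at h2
    exact congrArg (fun L : E →L[ℝ] ℝ => L w) (h2.mfderiv.symm.trans mfderiv_const)
  rw [h1, h2]
  have h4 : (r • w, w) = (r - 1) • (w, (0 : E)) + (w, w) := by
    ext <;> simp [sub_smul]
  rw [h4, map_add, map_smul, h3, add_zero, smul_eq_mul]

theorem continuousOn_conjDiff_dilation {h : G → ℝ} (hh : ContMDiff I 𝓘(ℝ, ℝ) ∞ h) {δ : G →* G}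
    (hδ : ContMDiff I I ∞ δ) {w : ℝ → E} {g : ℝ → G} (hg : HasLeftVelocity I w g) :
    ContinuousOn (fun s => conjDiff I h (δ (g s) * (g s)⁻¹, g s)) (Icc 0 1) := by
  have : IsTopologicalGroup G := topologicalGroup_of_lieGroup I ∞
  refine (continuous_conjDiff hh).comp_continuousOn (ContinuousOn.prodMk ?_ hg.continuousOn)
  exact (hδ.continuous.comp_continuousOn hg.continuousOn).mul hg.continuousOn.inv

/-- The fundamental theorem of calculus for `h` along the curve `t ↦ δ (g t) (g t)⁻¹`. -/
theorem sub_eq_integral_dilation [I.Boundaryless] {h : G → ℝ} (hh : ContMDiff I 𝓘(ℝ, ℝ) ∞ h)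
    {δ : G →* G} (hδ : ContMDiff I I ∞ δ) {r : ℝ} {w : ℝ → E}
    (hδw : ∀ t, (mfderiv I I δ 1 (w t) : E) = r • w t) (hw : Integrable w)
    {g : ℝ → G} (hg : HasLeftVelocity I w g) (hg0 : g 0 = 1) {t : ℝ} (ht : t ∈ Icc (0 : ℝ) 1) :
    h (δ (g t) * (g t)⁻¹) - h 1
      = (r - 1) * ∫ s in (0 : ℝ)..t, conjDiff I h (δ (g s) * (g s)⁻¹, g s) (w s) := by
  have hF : ContMDiff I 𝓘(ℝ, ℝ) 1 (fun x => h (δ x * x⁻¹)) :=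
    (hh.comp (hδ.mul contMDiff_id.inv)).of_le (by simp)
  have hint := integrableOn_clm_apply (continuousOn_conjDiff_dilation hh hδ hg) hw
  have := sub_eq_integral_of_acCurveAt hg.1 hg.2 hF
    (v := fun s => (r - 1) * conjDiff I h (δ (g s) * (g s)⁻¹, g s) (w s))
    (((intervalIntegrable_iff_integrableOn_Icc_of_le zero_le_one).2 hint).const_mul _)
    (fun s _ => diffAt_dilation hh hδ (hδw s) (g s)) t ht
  rwa [hg0, map_one, inv_one, mul_one, intervalIntegral.integral_const_mul] at this

/-- Dilations of factor close to `1` move the points of a horizontal curve only a little. -/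
theorem tendsto_dilation_mul_inv [I.Boundaryless] [FiniteDimensional ℝ E] {δ : ℝ → G →* G}
    (hδ : ∀ r > 0, ContMDiff I I ∞ (δ r)) {w : ℝ → E}
    (hδw : ∀ r > 0, ∀ t, (mfderiv I I (δ r) 1 (w t) : E) = r • w t) (hw : Integrable w)
    {g : ℝ → G} (hg : HasLeftVelocity I w g) (hg0 : g 0 = 1) {t : ℝ} (ht : t ∈ Icc (0 : ℝ) 1) :
    Tendsto (fun r => δ r (g t) * (g t)⁻¹) (𝓝 1) (𝓝 1) := by
  have : IsTopologicalGroup G := topologicalGroup_of_lieGroup I ∞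
  have : T1Space G := I.t1Space G
  refine ((SmoothBumpFunction.nhds_basis_support (I := I) (c := (1 : G))
    univ_mem).tendsto_right_iff).2 fun χ _ => ?_
  obtain ⟨C, hC0, hC⟩ := exists_bound_conjDiff χ.contMDiff χ.hasCompactSupport
    (isCompact_Icc.image_of_continuousOn hg.continuousOn)
  have hlim : Tendsto (fun r : ℝ => ‖r - 1‖ * (C * ∫ s, ‖w s‖)) (𝓝 1) (𝓝 0) := by
    have : Continuous fun r : ℝ => ‖r - 1‖ * (C * ∫ s, ‖w s‖) := by fun_prop
    simpa using this.tendsto 1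
  filter_upwards [lt_mem_nhds (zero_lt_one (α := ℝ)), hlim.eventually_lt_const one_pos]
    with r hr hr1
  have h1 := sub_eq_integral_dilation χ.contMDiff (hδ r hr) (hδw r hr) hw hg hg0 ht
  have h2 := norm_integral_conjDiff_le (z := fun s => (δ r (g s) * (g s)⁻¹, g s)) hC0 hw
    (fun s hs => hC (δ r (g s) * (g s)⁻¹) (g s) (mem_image_of_mem g hs)) ht
  intro h3
  rw [h3, χ.eq_one, zero_sub] at h1
  have h4 : (1 : ℝ) ≤ ‖r - 1‖ * (C * ∫ s, ‖w s‖) := by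
    calc (1 : ℝ) = ‖(-1 : ℝ)‖ := by simp
      _ = _ := by rw [h1, norm_mul]
      _ ≤ _ := by gcongr
  linarith

/-- The first variation of the endpoint `δ_r (g 1) (g 1)⁻¹` at `r = 1` is tangent to any subgroup
that contains `g 1` and is invariant under the dilations. -/
theorem integral_conjDiff_eq_zero [I.Boundaryless] [FiniteDimensional ℝ E] {δ : ℝ → G →* G}
    (hδ : ∀ r > 0, ContMDiff I I ∞ (δ r)) {w : ℝ → E}
    (hδw : ∀ r > 0, ∀ t, (mfderiv I I (δ r) 1 (w t) : E) = r • w t) (hw : Integrable w)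
    {g : ℝ → G} (hg : HasLeftVelocity I w g) (hg0 : g 0 = 1)
    {H : Subgroup G} (hδH : ∀ r > 0, ∀ x ∈ H, δ r x ∈ H) (hg1 : g 1 ∈ H)
    {h : G → ℝ} (hh : ContMDiff I 𝓘(ℝ, ℝ) ∞ h) (hsupp : HasCompactSupport h)
    (hhH : ∀ᶠ x in 𝓝 (1 : G), x ∈ H → h x = h 1) :
    ∫ s in (0 : ℝ)..1, conjDiff I h (1, g s) (w s) = 0 := by
  obtain ⟨C, hC0, hC⟩ := exists_bound_conjDiff hh hsupp
    (isCompact_Icc.image_of_continuousOn hg.continuousOn)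
  have hpos : ∀ᶠ r in 𝓝[≠] (1 : ℝ), 0 < r :=
    nhdsWithin_le_nhds (lt_mem_nhds zero_lt_one)
  have hzero : ∀ᶠ r in 𝓝[≠] (1 : ℝ),
      ∫ s in (0 : ℝ)..1, conjDiff I h (δ r (g s) * (g s)⁻¹, g s) (w s) = 0 := by
    have hlim := (tendsto_dilation_mul_inv hδ hδw hw hg hg0 (right_mem_Icc.2 zero_le_one)).mono_left
      (nhdsWithin_le_nhds (s := {1}ᶜ))
    filter_upwards [hpos, hlim.eventually hhH, self_mem_nhdsWithin] with r hr h1 hr1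
    have h2 := sub_eq_integral_dilation hh (hδ r hr) (hδw r hr) hw hg hg0
      (right_mem_Icc.2 zero_le_one)
    rw [h1 (H.mul_mem (hδH r hr _ hg1) (H.inv_mem hg1)), sub_self] at h2
    exact (mul_eq_zero.1 h2.symm).resolve_left (sub_ne_zero.2 hr1)
  refine tendsto_nhds_unique (l := 𝓝[≠] (1 : ℝ)) ?_
    (tendsto_const_nhds.congr' (hzero.mono fun r hr => hr.symm))
  refine intervalIntegral.tendsto_integral_filter_of_dominated_convergence
    (fun s => C * ‖w s‖) ?_ ?_ (hw.norm.const_mul C).intervalIntegrable ?_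
  · filter_upwards [hpos] with r hr
    exact ((intervalIntegrable_iff_integrableOn_Icc_of_le zero_le_one).2 (integrableOn_clm_apply
      (continuousOn_conjDiff_dilation hh (hδ r hr) hg) hw)).aestronglyMeasurable_restrict_uIoc
  · refine Eventually.of_forall fun r => Eventually.of_forall fun s hs => ?_
    rw [uIoc_of_le zero_le_one] at hs
    exact (conjDiff I h _).le_of_opNorm_le
      (hC _ _ (mem_image_of_mem g (Ioc_subset_Icc_self hs))) _
  · refine Eventually.of_forall fun s hs => ?_
    rw [uIoc_of_le zero_le_one] at hs
    have h1 := (tendsto_dilation_mul_inv hδ hδw hw hg hg0 (Ioc_subset_Icc_self hs)).mono_left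
      (nhdsWithin_le_nhds (s := {1}ᶜ))
    have h2 := ((continuous_conjDiff hh).tendsto (1, g s)).comp
      (h1.prodMk_nhds (tendsto_const_nhds (x := g s)))
    exact ((ContinuousLinearMap.apply ℝ ℝ (w s)).continuous.tendsto _).comp h2

end Dilation

end SubFinsler

/-! ### Auxiliary functions and the quotient norm -/

namespace SubFinsler

section Functions

variable {E : Type*} [NormedAddCommGroup E] [NormedSpace ℝ E]
  {B : Type*} [TopologicalSpace B] {J : ModelWithCorners ℝ E B}
  {M : Type*} [TopologicalSpace M] [ChartedSpace B M]

/-- Every covector is the differential of a function that is smooth near its base point. -/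
theorem exists_diffAt_eq [J.Boundaryless] [IsManifold J ∞ M] (y : M) (l : E →L[ℝ] ℝ) :
    ∃ (f : M → ℝ) (U : Set M), IsOpen U ∧ y ∈ U ∧ ContMDiffOn J 𝓘(ℝ, ℝ) ∞ f U ∧
      diffAt J f y = l := by
  have : IsManifold J 1 M := IsManifold.of_le (n := ∞) (by simp)
  have hinv := mfderivWithin_extChartAt_symm_comp_mfderiv_extChartAt'
    (mem_extChartAt_source (I := J) y)
  obtain ⟨D, hD⟩ : ∃ D : E →L[ℝ] E,
      D = mfderivWithin 𝓘(ℝ, E) J (extChartAt J y).symm (range J) (extChartAt J y y) := ⟨_, rfl⟩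
  refine ⟨fun z => l (D (extChartAt J y z)), (chartAt B y).source, (chartAt B y).open_source,
    mem_chart_source B y, ?_, ?_⟩
  · exact ((l.comp D).contDiff.contMDiff).comp_contMDiffOn (contMDiffOn_extChartAt (n := ∞))
  · have h1 : HasMFDerivAt J 𝓘(ℝ, E) (extChartAt J y) y (mfderiv J 𝓘(ℝ, E) (extChartAt J y) y) :=
      (mdifferentiableAt_extChartAt (mem_chart_source B y)).hasMFDerivAt
    have h2 : HasMFDerivAt 𝓘(ℝ, E) 𝓘(ℝ, ℝ) (l.comp D) (extChartAt J y y) (l.comp D) :=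
      (l.comp D).hasMFDerivAt
    refine (h2.comp y h1).mfderiv.trans ?_
    ext v
    subst hD
    exact congrArg (fun T : E →L[ℝ] E => l (T v)) hinv

/-- A function that is smooth near a point can be replaced by a smooth function with compact
support. -/
theorem exists_contMDiff_eventuallyEq [FiniteDimensional ℝ E] [T2Space M] [IsManifold J ∞ M]
    {ψ : M → ℝ} {x : M} {W : Set M} (hW : IsOpen W) (hx : x ∈ W)
    (hψ : ContMDiffOn J 𝓘(ℝ, ℝ) ∞ ψ W) :
    ∃ h : M → ℝ, ContMDiff J 𝓘(ℝ, ℝ) ∞ h ∧ HasCompactSupport h ∧ h =ᶠ[𝓝 x] ψ := by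
  obtain ⟨χ, -, hχ⟩ := (SmoothBumpFunction.nhds_basis_tsupport (I := J) x).mem_iff.1
    (hW.mem_nhds hx)
  refine ⟨fun z => χ z * ψ z, contMDiff_of_tsupport fun z hz => ?_,
    χ.hasCompactSupport.mul_right, ?_⟩
  · have hz' : z ∈ W := hχ (tsupport_mul_subset_left hz)
    exact χ.contMDiff.contMDiffAt.mul (hψ.contMDiffAt (hW.mem_nhds hz'))
  · filter_upwards [χ.eventuallyEq_one] with z hz
    rw [hz, Pi.one_apply, one_mul]

/-- A norm on `ℝ^m` is bounded below by a multiple of the standard norm. -/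
theorem exists_norm_le_seminorm {m : ℕ} (N : Seminorm ℝ (Fin m → ℝ))
    (hN : ∀ c, N c = 0 → c = 0) : ∃ C : ℝ, ∀ c, ‖c‖ ≤ C * N c := by
  have hle : ∀ c, N c ≤ (∑ i, N (Pi.single i 1)) * ‖c‖ := fun c => by
    calc N c = N (∑ i, c i • Pi.single i (1 : ℝ)) := by
          rw [← pi_eq_sum_univ' c]
      _ ≤ ∑ i, N (c i • Pi.single i (1 : ℝ)) :=
        Finset.le_sum_of_subadditive N (map_zero N).le (map_add_le_add N) _ _
      _ ≤ ∑ i, N (Pi.single i 1) * ‖c‖ := Finset.sum_le_sum fun i _ => by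
          rw [map_smul_eq_mul, mul_comm]
          gcongr
          exact norm_le_pi_norm c i
      _ = _ := by rw [Finset.sum_mul]
  have hcont : Continuous N := by
    have : LipschitzWith (∑ i, N (Pi.single i 1)).toNNReal N := by
      refine LipschitzWith.of_dist_le_mul fun c d => ?_
      rw [Real.coe_toNNReal _ (Finset.sum_nonneg fun i _ => apply_nonneg N _), dist_eq_norm,
        dist_eq_norm]
      exact (abs_sub_map_le_sub N c d).trans (hle _)
    exact this.continuous
  rcases (Metric.sphere (0 : Fin m → ℝ) 1).eq_empty_or_nonempty with hS | hS
  · refine ⟨0, fun c => ?_⟩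
    by_contra hc
    have hc0 : ‖c‖ ≠ 0 := fun h => hc (by rw [h]; simp)
    have : (‖c‖⁻¹ • c) ∈ Metric.sphere (0 : Fin m → ℝ) 1 := by
      rw [mem_sphere_zero_iff_norm, norm_smul, norm_inv, norm_norm, inv_mul_cancel₀ hc0]
    rw [hS] at this
    exact this
  · obtain ⟨c₀, hc₀, hmin⟩ := (isCompact_sphere (0 : Fin m → ℝ) 1).exists_isMinOn hS
      hcont.continuousOn
    rw [mem_sphere_zero_iff_norm] at hc₀
    have hpos : 0 < N c₀ := lt_of_le_of_ne (apply_nonneg N c₀) fun h => by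
      rw [hN c₀ h.symm, norm_zero] at hc₀
      exact zero_ne_one hc₀
    refine ⟨(N c₀)⁻¹, fun c => ?_⟩
    rcases eq_or_ne c 0 with rfl | hc
    · simp
    have hc0 : ‖c‖ ≠ 0 := norm_ne_zero_iff.2 hc
    have hmem : (‖c‖⁻¹ • c) ∈ Metric.sphere (0 : Fin m → ℝ) 1 := by
      rw [mem_sphere_zero_iff_norm, norm_smul, norm_inv, norm_norm, inv_mul_cancel₀ hc0]
    have h1 : N c₀ ≤ N (‖c‖⁻¹ • c) := hmin hmem
    rw [map_smul_eq_mul, norm_inv, norm_norm, inv_mul_eq_div, le_div_iff₀ (norm_pos_iff.2 hc)] at h1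
    rw [inv_mul_eq_div, le_div_iff₀ hpos]
    linarith

end Functions

end SubFinsler

namespace Carnot

open SubFinsler

section

variable {n k : ℕ} {G : Type*} [Group G] [TopologicalSpace G]
  [ChartedSpace (EuclideanSpace ℝ (Fin n)) G]

theorem IsDilation.mfderiv_one {s : ℕ} {V : ℕ → Submodule ℝ (GroupLieAlgebra (𝓡 n) G)}
    (hV : IsStratification s V) {r : ℝ} {δ : G →* G} (hδ : IsDilation s V r δ)
    {w : EuclideanSpace ℝ (Fin n)} (hw : w ∈ V 1) :
    (mfderiv (𝓡 n) (𝓡 n) δ 1 w : EuclideanSpace ℝ (Fin n)) = r • w := by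
  rcases Nat.eq_zero_or_pos s with rfl | hs
  · have h0 := hV.eq_bot
    rw [zero_add] at h0
    rw [h0] at hw
    obtain rfl : w = 0 := hw
    rw [smul_zero]
    exact map_zero (mfderiv (𝓡 n) (𝓡 n) δ 1)
  · have h := hδ.2 1 le_rfl hs w hw
    rw [pow_one] at h
    have h1 := (Bundle.TotalSpace.mk.inj h).2
    exact eq_of_heq h1

variable (H : Subgroup G) [ChartedSpace (EuclideanSpace ℝ (Fin k)) (RightQuotient H)]
  [LieGroup (𝓡 n) ∞ G]

/-- The projected fields at `p` depend linearly on the element of the first layer. -/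
theorem exists_linear_projField (hπ : MDifferentiable (𝓡 n) (𝓡 k) (proj H))
    (V₁ : Submodule ℝ (GroupLieAlgebra (𝓡 n) G)) (p : RightQuotient H) :
    ∃ P : V₁ →ₗ[ℝ] EuclideanSpace ℝ (Fin k),
      ∀ w : V₁, P w = projField H (w : GroupLieAlgebra (𝓡 n) G) p := by
  obtain ⟨q, rfl⟩ : ∃ q, proj H q = p := ⟨_, proj_out H p⟩
  have hA : ∃ A : GroupLieAlgebra (𝓡 n) G →ₗ[ℝ] EuclideanSpace ℝ (Fin k),
      ∀ w, A w = mfderiv (𝓡 n) (𝓡 k) (proj H) q (mulInvariantVectorField w q) :=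
    ⟨((mfderiv (𝓡 n) (𝓡 k) (proj H) q).comp
      (mfderiv (𝓡 n) (𝓡 n) (fun s => q * s) 1)).toLinearMap, fun _ => rfl⟩
  obtain ⟨A, hA⟩ := hA
  exact ⟨A ∘ₗ V₁.subtype, fun w => (hA w).trans (projField_proj H hπ w q).symm⟩

theorem exists_projField_eq (hπ : MDifferentiable (𝓡 n) (𝓡 k) (proj H)) {p : RightQuotient H}
    {v : TangentSpace (𝓡 k) p} {q : G} {w : GroupLieAlgebra (𝓡 n) G}
    (h : tangentMap (𝓡 n) (𝓡 k) (proj H) ⟨q, mulInvariantVectorField w q⟩ =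
      (⟨p, v⟩ : TangentBundle (𝓡 k) (RightQuotient H))) : projField H w p = v := by
  have h1 : proj H q = p := (Bundle.TotalSpace.mk.inj h).1
  subst h1
  rw [projField_proj H hπ]
  exact eq_of_heq (Bundle.TotalSpace.mk.inj h).2

theorem controlVel_projField {m : ℕ} {V₁ : Submodule ℝ (GroupLieAlgebra (𝓡 n) G)}
    (hπ : MDifferentiable (𝓡 n) (𝓡 k) (proj H)) (b : Fin m → V₁) (c : Fin m → ℝ)
    (p : RightQuotient H) :
    controlVel (𝓡 k) (fun i => projField H (b i : GroupLieAlgebra (𝓡 n) G)) c p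
      = projField H ((∑ i, c i • b i : V₁) : GroupLieAlgebra (𝓡 n) G) p := by
  obtain ⟨P, hP⟩ := exists_linear_projField H hπ V₁ p
  refine Eq.trans ?_ (hP _)
  rw [map_sum]
  refine Finset.sum_congr rfl fun i _ => ?_
  rw [map_smul]
  exact congrArg (fun v : EuclideanSpace ℝ (Fin k) => c i • v) (hP _).symm

theorem quotientNorm_zero {V₁ : Submodule ℝ (GroupLieAlgebra (𝓡 n) G)}
    (hπ : MDifferentiable (𝓡 n) (𝓡 k) (proj H)) (N : Seminorm ℝ V₁) (p : RightQuotient H) :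
    quotientNorm (k := k) H N p 0 = 0 := by
  obtain ⟨P, hP⟩ := exists_linear_projField H hπ V₁ p
  have h0 : projField H ((0 : V₁) : GroupLieAlgebra (𝓡 n) G) p = (0 : TangentSpace (𝓡 k) p) :=
    (hP 0).symm.trans (map_zero P)
  refine IsLeast.csInf_eq ⟨⟨p.out, 0, ?_, (map_zero N).symm⟩, ?_⟩
  · rw [← h0]
    exact (mk_projField H _ p).symm
  · rintro _ ⟨q, w, -, rfl⟩
    exact apply_nonneg N w

/-- The quotient norm is definite: by equivalence of norms on the first layer, horizontal lifts of
small norm have small projections. -/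
theorem eq_zero_of_quotientNorm_eq_zero {m : ℕ} {V₁ : Submodule ℝ (GroupLieAlgebra (𝓡 n) G)}
    (hπ : MDifferentiable (𝓡 n) (𝓡 k) (proj H)) (N : Seminorm ℝ V₁)
    (hN : ∀ v : V₁, N v = 0 → v = 0) (b : Module.Basis (Fin m) ℝ V₁) {p : RightQuotient H}
    (w : V₁) (h0 : quotientNorm (k := k) H N p
      (projField H (w : GroupLieAlgebra (𝓡 n) G) p) = 0) :
    projField (k := k) H (w : GroupLieAlgebra (𝓡 n) G) p = 0 := by
  obtain ⟨P, hP⟩ := exists_linear_projField H hπ V₁ p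
  obtain ⟨C, hC⟩ := exists_norm_le_seminorm (N.comp b.equivFun.symm.toLinearMap) fun c hc =>
    (LinearEquiv.map_eq_zero_iff _).1 (hN _ hc)
  obtain ⟨v, hv⟩ : ∃ v : EuclideanSpace ℝ (Fin k),
      v = projField H (w : GroupLieAlgebra (𝓡 n) G) p := ⟨_, rfl⟩
  have hbound : ∀ (q : G) (w' : V₁), tangentMap (𝓡 n) (𝓡 k) (proj H)
      ⟨q, mulInvariantVectorField (w' : GroupLieAlgebra (𝓡 n) G) q⟩ =
      (⟨p, v⟩ : TangentBundle (𝓡 k) (RightQuotient H)) →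
      ‖v‖ ≤ (∑ i, ‖P (b i)‖) * C * N w' := by
    intro q w' hw'
    have h3 : v = ∑ i, b.equivFun w' i • P (b i) := by
      have h2 : v = P w' := (exists_projField_eq H hπ hw').symm.trans (hP _).symm
      rw [h2]
      conv_lhs => rw [← b.sum_equivFun w', map_sum]
      simp only [map_smul]
    have h4 : ‖b.equivFun w'‖ ≤ C * N w' := by
      have := hC (b.equivFun w')
      rwa [Seminorm.comp_apply, LinearEquiv.coe_coe, LinearEquiv.symm_apply_apply] at this
    calc ‖v‖ ≤ ∑ i, ‖b.equivFun w' i • P (b i)‖ := by rw [h3]; exact norm_sum_le _ _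
      _ ≤ ∑ i, ‖P (b i)‖ * (C * N w') := Finset.sum_le_sum fun i _ => by
          rw [norm_smul, mul_comm]
          gcongr
          exact (norm_le_pi_norm _ i).trans h4
      _ = _ := by rw [← Finset.sum_mul, mul_assoc]
  set A := (∑ i, ‖P (b i)‖) * C
  have hle : ∀ ε > 0, ‖v‖ ≤ |A| * ε := fun ε hε => by
    have hne : {r : ℝ | ∃ (q : G) (w' : V₁), tangentMap (𝓡 n) (𝓡 k) (proj H)
        ⟨q, mulInvariantVectorField (w' : GroupLieAlgebra (𝓡 n) G) q⟩ =
        (⟨p, v⟩ : TangentBundle (𝓡 k) (RightQuotient H)) ∧ r = N w'}.Nonempty :=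
      ⟨N w, p.out, w, by rw [hv]; exact (mk_projField H _ p).symm, rfl⟩
    have hlt : sInf {r : ℝ | ∃ (q : G) (w' : V₁), tangentMap (𝓡 n) (𝓡 k) (proj H)
        ⟨q, mulInvariantVectorField (w' : GroupLieAlgebra (𝓡 n) G) q⟩ =
        (⟨p, v⟩ : TangentBundle (𝓡 k) (RightQuotient H)) ∧ r = N w'} < ε := by
      rw [hv]
      exact lt_of_eq_of_lt h0 hε
    obtain ⟨_, ⟨q, w', hw', rfl⟩, hlt'⟩ := exists_lt_of_csInf_lt hne hlt
    refine (hbound q w' hw').trans ?_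
    exact mul_le_mul (le_abs_self A) hlt'.le (apply_nonneg N w') (abs_nonneg A)
  have hv0 : ‖v‖ ≤ 0 := by
    refine le_of_forall_pos_le_add fun ε hε => ?_
    have h1 := hle (ε / (|A| + 1)) (by positivity)
    have h2 : |A| * (ε / (|A| + 1)) ≤ ε := by
      rw [mul_div_assoc', div_le_iff₀ (by positivity)]
      nlinarith
    linarith
  exact hv.symm.trans (norm_le_zero_iff.1 hv0)

end

end Carnot

/-! ### Normal loops -/

namespace Carnot

open SubFinsler

section

variable {n k m : ℕ} {G : Type*} [Group G] [TopologicalSpace G]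
  [ChartedSpace (EuclideanSpace ℝ (Fin n)) G] [LieGroup (𝓡 n) ∞ G]
  (H : Subgroup G) [ChartedSpace (EuclideanSpace ℝ (Fin k)) (RightQuotient H)]
  [IsManifold (𝓡 k) ∞ (RightQuotient H)]

/-- The value of the dual curve on the velocity, read in the group: it is the derivative of a
function on `G`, independent of `t`, along the conjugate of the control by the lift of the curve. -/
theorem exists_function_conjDiff_eq (hproj : Manifold.IsSubmersion (𝓡 n) (𝓡 k) ∞ (proj H))
    (φ : ℝ → (RightQuotient H ≃ₘ⟮𝓡 k, 𝓡 k⟯ RightQuotient H)) (g : ℝ → G)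
    (hφ : ∀ t ∈ Icc (0 : ℝ) 1, ∀ p, φ t p = act H p (g t))
    (l : EuclideanSpace ℝ (Fin k) →L[ℝ] ℝ) :
    ∃ h : G → ℝ, ContMDiff (𝓡 n) 𝓘(ℝ, ℝ) ∞ h ∧ HasCompactSupport h ∧
      (∀ᶠ x in 𝓝 (1 : G), x ∈ H → h x = h 1) ∧
      ∀ t ∈ Icc (0 : ℝ) 1, ∀ w : GroupLieAlgebra (𝓡 n) G, conjDiff (𝓡 n) h (1, g t) w
        = l (mfderiv (𝓡 k) (𝓡 k) (flowFromTo (𝓡 k) φ t 1) (proj H (g t))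
            (projField H w (proj H (g t)))) := by
  have : IsTopologicalGroup G := topologicalGroup_of_lieGroup (𝓡 n) ∞
  have : T1Space G := (𝓡 n).t1Space G
  have hπ : MDifferentiable (𝓡 n) (𝓡 k) (proj H) := hproj.contMDiff.mdifferentiable (by simp)
  obtain ⟨f, U, hU, hyU, hf, hfl⟩ := exists_diffAt_eq (J := 𝓡 k) (φ 1 (proj H 1)) l
  have hΦ : ContMDiff (𝓡 n) (𝓡 k) ∞ (fun x => φ 1 (proj H x)) :=
    (φ 1).contMDiff.comp hproj.contMDiff
  obtain ⟨h, hh, hsupp, heq⟩ := exists_contMDiff_eventuallyEq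
    (ψ := fun x => f (φ 1 (proj H x))) (x := (1 : G)) (hU.preimage hΦ.continuous) hyU
    (hf.comp hΦ.contMDiffOn fun x hx => hx)
  refine ⟨h, hh, hsupp, ?_, fun t ht w => ?_⟩
  · filter_upwards [heq] with x hx hxH
    rw [hx, heq.eq_of_nhds]
    have : proj H x = proj H 1 := (proj_eq_iff H).2 (by simpa using H.inv_mem hxH)
    simp only [this]
  · have hflow : ∀ s : G, φ 1 (proj H (g t * s * (g t)⁻¹))
        = flowFromTo (𝓡 k) φ t 1 (proj H (g t * s)) := fun s => by
      have h1 : φ t (proj H (g t * s * (g t)⁻¹)) = proj H (g t * s) := by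
        rw [hφ t ht, act_proj, inv_mul_cancel_right]
      change _ = φ 1 ((φ t).symm (proj H (g t * s)))
      rw [← h1, Diffeomorph.symm_apply_apply]
    have hconj : Continuous fun s : G => g t * s * (g t)⁻¹ := by fun_prop
    have heq' : (fun s : G => h (1 * (g t * s * (g t)⁻¹))) =ᶠ[𝓝 1]
        fun s => f (flowFromTo (𝓡 k) φ t 1 (proj H (g t * s))) := by
      have h1 : Tendsto (fun s : G => g t * s * (g t)⁻¹) (𝓝 1) (𝓝 1) := by
        have := hconj.tendsto 1
        rwa [mul_one, mul_inv_cancel] at this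
      filter_upwards [h1.eventually heq] with s hs
      rw [one_mul, hs, hflow]
    have hend : flowFromTo (𝓡 k) φ t 1 (proj H (g t)) = φ 1 (proj H 1) := by
      have := hflow 1
      rw [mul_one, mul_inv_cancel] at this
      exact this.symm
    have hFl : HasMFDerivAt (𝓡 k) (𝓡 k) (flowFromTo (𝓡 k) φ t 1) (proj H (g t))
        (mfderiv (𝓡 k) (𝓡 k) (flowFromTo (𝓡 k) φ t 1) (proj H (g t))) :=
      ((flowFromTo (𝓡 k) φ t 1).contMDiff.mdifferentiableAt (by simp)).hasMFDerivAt
    have hfd : HasMFDerivAt (𝓡 k) 𝓘(ℝ, ℝ) f (flowFromTo (𝓡 k) φ t 1 (proj H (g t))) l := by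
      rw [hend, ← hfl]
      exact ((hf.contMDiffAt (hU.mem_nhds hyU)).mdifferentiableAt (by simp)).hasMFDerivAt
    have hcomp := (hfd.comp _ hFl).comp (g t) (hπ (g t)).hasMFDerivAt
    have h2 : conjDiff (𝓡 n) h (1, g t)
        = diffAt (𝓡 n) (fun s => f (flowFromTo (𝓡 k) φ t 1 (proj H (g t * s)))) 1 :=
      heq'.mfderiv_eq
    rw [h2]
    refine (diffAt_comp_mul_left (f := fun x => f (flowFromTo (𝓡 k) φ t 1 (proj H x)))
      hcomp.mdifferentiableAt w).trans ?_
    rw [projField_proj H hπ w (g t)]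
    exact congrArg (fun T : EuclideanSpace ℝ (Fin n) →L[ℝ] ℝ => T (leftField (𝓡 n) w (g t)))
      hcomp.mfderiv

/-- A normal loop on `[0,1]` based at the origin is constant. -/
theorem eq_of_isNormalCurve {s : ℕ}
    {V : ℕ → Submodule ℝ (GroupLieAlgebra (𝓡 n) G)} (hV : IsStratification s V)
    (N : Seminorm ℝ (V 1)) (hN : ∀ v : V 1, N v = 0 → v = 0)
    (hHdil : IsDilationInvariant s V H)
    (hproj : Manifold.IsSubmersion (𝓡 n) (𝓡 k) ∞ (proj H)) (b : Module.Basis (Fin m) ℝ (V 1))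
    {γ : ℝ → RightQuotient H}
    (hγ : IsNormalCurve (𝓡 k) (fun i => projField H (b i : GroupLieAlgebra (𝓡 n) G))
      (quotientNorm H N) γ)
    (hγ0 : γ 0 = proj H 1) (hγ1 : γ 1 = proj H 1) : ∀ t ∈ Icc (0 : ℝ) 1, γ t = proj H 1 := by
  obtain ⟨u, φ, l, hu, hφ, hγu, hγφ, hl⟩ := hγ
  have hπ : MDifferentiable (𝓡 n) (𝓡 k) (proj H) := hproj.contMDiff.mdifferentiable (by simp)
  have : IsManifold (𝓡 k) 1 (RightQuotient H) := IsManifold.of_le (n := ∞) (by simp)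
  -- the control as an integrable curve in the first layer
  let ξ : ℝ → V 1 := fun t => ∑ i, (Icc (0 : ℝ) 1).indicator u t i • b i
  let w : ℝ → EuclideanSpace ℝ (Fin n) := fun t => (ξ t : GroupLieAlgebra (𝓡 n) G)
  have hw : Integrable w := by
    let L : (Fin m → ℝ) →ₗ[ℝ] EuclideanSpace ℝ (Fin n) :=
      (V 1).subtype ∘ₗ b.equivFun.symm.toLinearMap
    have h1 : Integrable ((Icc (0 : ℝ) 1).indicator u) :=
      (integrable_indicator_iff measurableSet_Icc).2 (hu.integrable one_le_two)
    have h2 := (LinearMap.toContinuousLinearMap L).integrable_comp h1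
    refine h2.congr (Eventually.of_forall fun t => ?_)
    change ((b.equivFun.symm ((Icc (0 : ℝ) 1).indicator u t) : V 1) : GroupLieAlgebra (𝓡 n) G) = ξ t
    rw [Module.Basis.equivFun_symm_apply]
  have hvel : ∀ t ∈ Icc (0 : ℝ) 1, ∀ p : RightQuotient H,
      controlVel (𝓡 k) (fun i => projField H (b i : GroupLieAlgebra (𝓡 n) G)) (u t) p
        = projField H (ξ t : GroupLieAlgebra (𝓡 n) G) p := fun t ht p => by
    rw [controlVel_projField H hπ]
    simp only [ξ, indicator_of_mem ht]
  -- the lift of the control to the group and the formula for the flow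
  obtain ⟨g, hg, hg0⟩ := exists_hasLeftVelocity (I := 𝓡 n) (G := G) hw
  have hcurve : ∀ p : ℝ → RightQuotient H,
      HasControl (𝓡 k) (fun i => projField H (b i : GroupLieAlgebra (𝓡 n) G)) u p →
      ∀ᵐ t, t ∈ Icc (0 : ℝ) 1 → HasMFDerivAt 𝓘(ℝ, ℝ) (𝓡 k) p t
        ((1 : ℝ →L[ℝ] ℝ).smulRight (projField H (ξ t : GroupLieAlgebra (𝓡 n) G) (p t))) := by
    intro p hp
    filter_upwards [(ae_restrict_iff' measurableSet_Icc).1 hp.2] with t h ht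
    rw [← hvel t ht]
    exact h ht
  have hflow : ∀ t ∈ Icc (0 : ℝ) 1, ∀ p, φ t p = act H p (g t) := by
    intro t ht p
    have h1 := eq_act_of_velocity H hproj hg hg0 (p := fun t => φ t p)
      (fun t ht => (hφ p).2.1.acCurveAt ht) (hcurve _ (hφ p).2) t ht
    rwa [(hφ p).1] at h1
  have hγg : ∀ t ∈ Icc (0 : ℝ) 1, γ t = proj H (g t) := fun t ht => by
    rw [hγφ t ht, hflow t ht, hγ0, act_proj, one_mul]
  have hg1 : g 1 ∈ H := by
    have h1 := hγg 1 (right_mem_Icc.2 zero_le_one)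
    rw [hγ1, proj_eq_iff] at h1
    simpa using h1
  -- the first variation under the dilations
  obtain ⟨h, hh, hsupp, hhH, hconj⟩ := exists_function_conjDiff_eq H hproj φ g hflow l
  have hδ : ∀ r : ℝ, ∃ δ : G →* G, 0 < r → IsDilation s V r δ ∧ ∀ x ∈ H, δ x ∈ H := fun r => by
    by_cases hr : 0 < r
    · obtain ⟨δ, hδ⟩ := hHdil r hr
      exact ⟨δ, fun _ => hδ⟩
    · exact ⟨1, fun h => absurd h hr⟩
  choose δ hδ using hδ
  have hzero := integral_conjDiff_eq_zero (fun r hr => (hδ r hr).1.1)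
    (fun r hr t => (hδ r hr).1.mfderiv_one hV (ξ t).2) hw hg hg0 (fun r hr => (hδ r hr).2) hg1
    hh hsupp hhH
  -- the integrand dominates the energy
  have hint : IntegrableOn (fun t => conjDiff (𝓡 n) h (1, g t) (w t)) (Icc 0 1) :=
    integrableOn_clm_apply ((continuous_conjDiff hh).comp_continuousOn
      (continuousOn_const.prodMk hg.continuousOn)) hw
  have hener : ∀ᵐ t, t ∈ Icc (0 : ℝ) 1 →
      (1 / 2) * quotientNorm (k := k) H N (γ t)
          (projField H (ξ t : GroupLieAlgebra (𝓡 n) G) (γ t)) ^ 2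
        ≤ conjDiff (𝓡 n) h (1, g t) (w t) := by
    filter_upwards [(ae_restrict_iff' measurableSet_Icc).1 hl] with t h1 ht
    -- the sub-differential inequality at the vector `0`
    have h2 := (h1 ht).2 0 (Submodule.zero_mem _)
    rw [hvel t ht, hγg t ht] at h2
    simp only [energy, quotientNorm_zero H hπ] at h2
    have h3 := hconj t ht (ξ t : GroupLieAlgebra (𝓡 n) G)
    rw [hγg t ht]
    obtain ⟨T, hT⟩ : ∃ T : EuclideanSpace ℝ (Fin k) →L[ℝ] ℝ, ∀ v, T v =
        l (mfderiv (𝓡 k) (𝓡 k) (flowFromTo (𝓡 k) φ t 1) (proj H (g t)) v) :=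
      ⟨l.comp (mfderiv (𝓡 k) (𝓡 k) (flowFromTo (𝓡 k) φ t 1) (proj H (g t))), fun _ => rfl⟩
    have hneg : ∀ v, T (0 - v) = -T v := fun v => by rw [zero_sub, map_neg]
    have h4 : _ = -conjDiff (𝓡 n) h (1, g t) (w t) :=
      (hneg (projField H (ξ t : GroupLieAlgebra (𝓡 n) G) (proj H (g t)))).trans
        (congrArg Neg.neg ((hT _).trans h3.symm))
    have h5 := (hT _).symm.trans h4
    have h6 := h5.symm.trans_le h2
    linarith
  have hnonneg : ∀ᵐ t ∂(volume.restrict (Icc (0 : ℝ) 1)),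
      0 ≤ conjDiff (𝓡 n) h (1, g t) (w t) := by
    refine (ae_restrict_iff' measurableSet_Icc).2 ?_
    filter_upwards [hener] with t h1 ht
    exact le_trans (by positivity) (h1 ht)
  rw [intervalIntegral.integral_of_le zero_le_one, ← integral_Icc_eq_integral_Ioc,
    setIntegral_eq_zero_iff_of_nonneg_ae hnonneg hint] at hzero
  have hvzero : ∀ᵐ t, t ∈ Icc (0 : ℝ) 1 →
      projField H (ξ t : GroupLieAlgebra (𝓡 n) G) (γ t) = (0 : TangentSpace (𝓡 k) (γ t)) := by
    filter_upwards [hener, (ae_restrict_iff' measurableSet_Icc).1 hzero] with t h1 h2 ht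
    refine eq_zero_of_quotientNorm_eq_zero H hπ N hN b (ξ t) ?_
    have h3 := h1 ht
    rw [h2 ht] at h3
    have h4 : quotientNorm (k := k) H N (γ t)
        (projField H (ξ t : GroupLieAlgebra (𝓡 n) G) (γ t)) ^ 2 ≤ 0 := by
      simp only [Pi.zero_apply] at h3
      linarith
    exact pow_eq_zero_iff two_ne_zero |>.1 (le_antisymm h4 (sq_nonneg _))
  intro t ht
  rw [← hγ0]
  refine eq_of_acCurveAt_of_velocity_zero (J := 𝓡 k) (fun t ht => hγu.1.acCurveAt ht) ?_ t ht
  filter_upwards [hvzero, hcurve γ hγu] with t h1 h2 ht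
  rw [← h1 ht]
  exact h2 ht

end

end Carnot

end

theorem theorem3p4 {n k m s : ℕ} {G : Type*} [Group G] [TopologicalSpace G]
    [ChartedSpace (EuclideanSpace ℝ (Fin n)) G] [LieGroup (𝓡 n) ∞ G] [SimplyConnectedSpace G]
    -- the stratification of the Lie algebra and the norm on the first layer
    (V : ℕ → Submodule ℝ (GroupLieAlgebra (𝓡 n) G)) (hV : Carnot.IsStratification s V)
    (N : Seminorm ℝ (V 1)) (hN : ∀ v : V 1, N v = 0 → v = 0)
    -- the closed dilation-invariant subgroup
    (H : Subgroup G) (hHclosed : IsClosed (H : Set G)) (hHdil : Carnot.IsDilationInvariant s V H)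
    (hHtrans : ∀ v ∈ V 1, v ∈ Carnot.tangentAtOne H → v = 0)
    -- the quotient smooth structure on `H \ G`: the one for which the projection is a submersion
    [ChartedSpace (EuclideanSpace ℝ (Fin k)) (Carnot.RightQuotient H)]
    [IsManifold (𝓡 k) ∞ (Carnot.RightQuotient H)]
    (hproj : Manifold.IsSubmersion (𝓡 n) (𝓡 k) ∞ (Carnot.proj H))
    -- a left-invariant frame of the horizontal distribution
    (b : Module.Basis (Fin m) ℝ (V 1))
    -- a normal loop, parametrized by an arbitrary compact interval
    (γ : ℝ → Carnot.RightQuotient H) (a c : ℝ) (hac : a < c)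
    (hγ : SubFinsler.IsNormalCurve (𝓡 k) (fun i => Carnot.projField H (b i : GroupLieAlgebra (𝓡 n) G))
      (Carnot.quotientNorm H N) (fun t => γ (a + (c - a) * t)))
    (hγa : γ a = Carnot.proj H 1) (hγc : γ c = Carnot.proj H 1) :
    ∀ t ∈ Set.Icc a c, γ t = Carnot.proj H 1 := by
  intro t ht
  have hac' : 0 < c - a := sub_pos.2 hac
  have h := Carnot.eq_of_isNormalCurve H hV N hN hHdil hproj b hγ (by simpa using hγa)
    (by simpa using hγc) ((t - a) / (c - a))
    ⟨div_nonneg (sub_nonneg.2 ht.1) hac'.le, (div_le_one hac').2 (by linarith [ht.2])⟩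
  simpa [mul_div_cancel₀ _ hac'.ne'] using h
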